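/- All spaces are topological spaces, $I=[0,1]$, path spaces carry the compact-open topology, and paracompact spaces are Hausdorff. The join $A*B$ consists of the formal combinations $(1-t)a+tb$ with $t\in I$, $a\in A$, $b\in B$, where $a$ is forgotten if $t=1$ and $b$ is forgotten if $t=0$ (so $A*\varnothing=A$ and $\varnothing*B=B$). It carries the coarsest topology for which $t:A*B\to I$ and the partial maps $\{t\neq1\}\to A$ and $\{t\neq0\}\to B$, with open domains, are continuous. The join of $k+1$ copies of $F$ is $*^{1}F=F$, $*^{k+1}F=F*(*^{k}F)$. Let $A\subset Z$, let $P_AZ$ be the space of paths $\phi:I\to Z$ with $\phi(0)\in A$, and let $p_A:P_AZ\to Z$, $p_A(\phi)=\phi(1)$. A map $f:X\to Y$ together with a subset $X'\subset X$ is a *stratified locally trivial bundle with fiber $(Z,A)$* if $f$ is continuous, $(f^{-1}(y),f^{-1}(y)\cap X')\cong(Z,A)$ as pairs for all $y\in Y$, and $Y$ has a cover by open sets $U$ for which there is a fiber preserving homeomorphism of pairs $(f^{-1}(U),f^{-1}(U)\cap X')\cong(Z\times U,A\times U)$. Given such data, let $$E_0=\{\phi\in C(I,X)\mid f\phi(s)=f\phi(0)\text{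 for all }s\in I,\ \phi(0)\in X'\},\qquad \xi_0:E_0\to X,\quad \xi_0(\phi)=\phi(1),$$ and inductively let $E_k\subset E_0*E_{k-1}$ be the subspace which is the union of all intervals $[\phi,\psi]=\{(1-t)\phi+t\psi\mid t\in I\}$ with $\phi\in E_0$, $\psi\in E_{k-1}$ and $\xi_0(\phi)=\xi_{k-1}(\psi)$, and let $\xi_k:E_k\to X$ send all points of $[\phi,\psi]$ to $\xi_0(\phi)=\xi_{k-1}(\psi)$. **Lemma.** Let $X$ and $Y$ be paracompact and let $f:X\to Y$, with $X'\subset X$, be a stratified locally trivial bundle with fiber $(Z,A)$, where $A$ is contractible in $Z$ (the inclusion $A\to Z$ is homotopic to a constant map). Let $k\ge0$. Then: 1. $\xi_k:E_k\to X$ is a Hurewicz fibration, i.e. it is continuous and has the homotopy lifting property with respect to all topological spaces. 2. The fiber of $\xi_k$ is the join of $k+1$ copies of the fiber of $p_A$. Precisely, let $y\in Y$, let $e:(f^{-1}(y),f^{-1}(y)\cap X')\to(Z,A)$ be any homeomorphism of pairs, and let $x\in f^{-1}(y)$. Then $\xi_k^{-1}(x)$ is homeomorphic to $*^{k+1}p_A^{-1}(e(x))$,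 and it is homotopy equivalent to $*^{k+1}p_A^{-1}(z)$ for every $z\in Z$ that can be joined to $e(x)$ by a path in $Z$ (hence for every $z\in Z$ if $Z$ is path connected). 3. If $\xi_k$ has a continuous section, then $X$ has an open cover $\{U_0,\dots,U_k\}$ such that each $U_i$ admits a fiberwise deformation into $X'$, i.e. a homotopy $H:U_i\times I\to X$ with $H(x,0)=x$, $H(x,1)\in X'$ and $f(H(x,t))=f(x)$ for all $x\in U_i$ and $t\in I$. -/

import Mathlib

universe u v w

/-! ### Hurewicz fibrations -/

/-- A map `p : E → B` is a Hurewicz fibration if it is continuous and has the homotopy lifting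
property with respect to all topological spaces `W` (of an arbitrary universe `w`). -/
def IsHurewiczFibration {E : Type u} {B : Type v} [TopologicalSpace E] [TopologicalSpace B]
    (p : E → B) : Prop :=
  Continuous p ∧
    ∀ (W : Type w) [TopologicalSpace W] (h : C(W × unitInterval, B)) (g : C(W, E)),
      (∀ x, p (g x) = h (x, 0)) →
        ∃ H : C(W × unitInterval, E), (∀ x, H (x, 0) = g x) ∧ ∀ z, p (H z) = h z

/-! ### Joins -/

/-- The join `A ∗ B` of two spaces. A point is a formal convex combination `(1 - t) a + t b`, where
`a` is forgotten (`none`) exactly if `t = 1` and `b` is forgotten exactly if `t = 0`.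
In particular `A ∗ ∅ = A` and `∅ ∗ B = B`. -/
@[ext]
structure TopJoin (A : Type u) (B : Type v) where
  /-- the barycentric coordinate -/
  t : unitInterval
  /-- the point of `A`, present if its weight `1 - t` is nonzero -/
  left : Option A
  /-- the point of `B`, present if its weight `t` is nonzero -/
  right : Option B
  left_isSome : left.isSome ↔ t ≠ 1
  right_isSome : right.isSome ↔ t ≠ 0

/-- The topology of the join: the coarsest one for which the barycentric coordinate
`t : A ∗ B → [0,1]`, the partial map `{t ≠ 1} → A` and the partial map `{t ≠ 0} → B`
(with open domains of definition) are continuous. -/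
instance TopJoin.instTopologicalSpace {A : Type u} {B : Type v} [TopologicalSpace A]
    [TopologicalSpace B] : TopologicalSpace (TopJoin A B) :=
  TopologicalSpace.generateFrom
    ({S | ∃ V : Set unitInterval, IsOpen V ∧ S = {z | z.t ∈ V}} ∪
      {S | ∃ V : Set A, IsOpen V ∧ S = {z | ∃ a ∈ V, z.left = some a}} ∪
      {S | ∃ V : Set B, IsOpen V ∧ S = {z | ∃ b ∈ V, z.right = some b}})

open Classical in
/-- The point `(1 - t) a + t b` of the interval `[a, b] ⊆ A ∗ B`. -/
noncomputable def TopJoin.seg {A : Type u} {B : Type v} (a : A) (b : B) (t : unitInterval) :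
    TopJoin A B where
  t := t
  left := if t = 1 then none else some a
  right := if t = 0 then none else some b
  left_isSome := by split_ifs with h <;> simp [h]
  right_isSome := by split_ifs with h <;> simp [h]

/-- `joinPower F k` is the join of `k + 1` copies of the space `F`. -/
def joinPower (F : TopCat.{u}) : ℕ → TopCat.{u}
  | 0 => F
  | k + 1 => TopCat.of (TopJoin F (joinPower F k))

/-! ### Fiberwise joins -/

/-- A space together with a map to `X`. -/
structure SpaceOver (X : Type u) where
  /-- the total space -/
  total : Type u
  [top : TopologicalSpace total]
  /-- the map to `X` -/
  proj : total → X

instance SpaceOver.instTopologicalSpace {X : Type u} (E : SpaceOver X) :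
    TopologicalSpace E.total := E.top

/-- The map on `E ∗ E'` which is `p` on points with a nonzero `E`-coordinate and `q` on `E'`. -/
noncomputable def TopJoin.elim {E : Type u} {E' : Type v} {X : Type w} (p : E → X) (q : E' → X)
    (z : TopJoin E E') : X :=
  open Classical in
  if h : z.t = 1 then q (z.right.get (z.right_isSome.2 (by rw [h]; exact one_ne_zero)))
  else p (z.left.get (z.left_isSome.2 h))

theorem TopJoin.elim_seg {E : Type u} {E' : Type v} {X : Type w} (p : E → X) (q : E' → X)
    {a : E} {b : E'} (hab : p a = q b) (t : unitInterval) :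
    TopJoin.elim p q (TopJoin.seg a b t) = p a := by
  by_cases h : t = 1 <;> simp [TopJoin.elim, TopJoin.seg, h, hab]

/-- The fiberwise join of `p : E → X` and `q : E' → X`: the subspace of `E ∗ E'` which is the union
of all intervals `[a, b]` with `p a = q b`, with the projection which maps such an interval to the
point `p a = q b`. -/
noncomputable def SpaceOver.fiberJoin {X : Type u} (E E' : SpaceOver X) : SpaceOver X where
  total := {z : TopJoin E.total E'.total //
    ∃ a b, E.proj a = E'.proj b ∧ ∃ t, z = TopJoin.seg a b t}
  proj z := TopJoin.elim E.proj E'.proj z.1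

/-! ### Stratified bundles and the maps `ξ_k` -/

/-- `f : X → Y`, with the substratum `X' ⊆ X`, is a stratified locally trivial bundle (with two
strata) with fiber `(Z, A)`: all pairs `(f⁻¹(y), f⁻¹(y) ∩ X')` are homeomorphic to `(Z, A)`, and
`Y` is covered by open sets `U` such that `(f⁻¹(U), f⁻¹(U) ∩ X')` is homeomorphic to
`(Z × U, A × U)` by a fiber preserving homeomorphism. -/
structure IsStratifiedBundle {X : Type*} {Y : Type*} {Z : Type*} [TopologicalSpace X]
    [TopologicalSpace Y] [TopologicalSpace Z] (f : X → Y) (X' : Set X) (A : Set Z) : Prop where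
  continuous : Continuous f
  fiber : ∀ y : Y, ∃ e : (f ⁻¹' {y}) ≃ₜ Z, ∀ x, e x ∈ A ↔ (x : X) ∈ X'
  locally_trivial : ∀ y : Y, ∃ U : Set Y, IsOpen U ∧ y ∈ U ∧
    ∃ e : (f ⁻¹' U) ≃ₜ Z × U, (∀ x, ((e x).2 : Y) = f x) ∧ ∀ x, (e x).1 ∈ A ↔ (x : X) ∈ X'

/-- `ξ_0 : E_0 → X`: the space of all paths in `X` which stay in one fiber of `f` and start in `X'`,
with the topology inherited from `C([0,1], X)`, mapped to `X` by `φ ↦ φ(1)`. -/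
def verticalPaths {X : Type u} {Y : Type v} [TopologicalSpace X] (f : X → Y) (X' : Set X) :
    SpaceOver X where
  total := {φ : C(unitInterval, X) // (∀ s, f (φ s) = f (φ 0)) ∧ φ 0 ∈ X'}
  proj φ := φ.1 1

/-- `ξ_k : E_k → X`, the fiberwise join of `k + 1` copies of `ξ_0 : E_0 → X`. -/
noncomputable def ganeaBundle {X : Type u} {Y : Type v} [TopologicalSpace X] (f : X → Y)
    (X' : Set X) : ℕ → SpaceOver X
  | 0 => verticalPaths f X'
  | k + 1 => (verticalPaths f X').fiberJoin (ganeaBundle f X' k)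

/-- `P_A Z`, the space of paths in `Z` issued from `A`. -/
abbrev PathsFrom {Z : Type v} [TopologicalSpace Z] (A : Set Z) : Type v :=
  {φ : C(unitInterval, Z) // φ 0 ∈ A}

/-- The evaluation `p_A : P_A Z → Z`, `φ ↦ φ(1)`. -/
def pathsFromEnd {Z : Type v} [TopologicalSpace Z] (A : Set Z) (φ : PathsFrom A) : Z := φ.1 1

/-- `A ⊆ Z` is contractible in `Z`: the inclusion is homotopic in `Z` to a constant map. -/
def ContractibleIn {Z : Type v} [TopologicalSpace Z] (A : Set Z) : Prop :=
  ContinuousMap.Nullhomotopic (⟨Subtype.val, continuous_subtype_val⟩ : C(A, Z))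

/-- `U ⊆ X` is fiberwise (over `f : X → Y`) deformable in `X` into `X'`. -/
def FiberwiseDeformable {X : Type u} {Y : Type v} [TopologicalSpace X] (f : X → Y)
    (U X' : Set X) : Prop :=
  ∃ H : C(U × unitInterval, X), (∀ x, H (x, 0) = x) ∧ (∀ x, H (x, 1) ∈ X') ∧
    ∀ x s, f (H (x, s)) = f x

/-! The fibration property is proved in a stronger form, `HasPathLifting`: a path lifting function
depending continuously on the path and the initial point. This form passes to fiberwise joins, since
both join coordinates can be lifted separately (`hasPathLifting_fiberJoin`), so only `ξ_0` needs
work.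

For `ξ_0` the main input is a continuous transport of points of `X` along paths of `Y` that
preserves `X'` (`IsStratifiedBundle.exists_transport`). Given a vertical path `φ` ending at `γ 0`,
its lift at time `t` is `φ` transported along `f ∘ γ` up to time `t`, followed by the vertical path
`s ↦ γ s` transported from `f (γ s)` to `f (γ t)`, for `s ≤ t`; this ends at `γ t`. Local transports
come from finitely many trivializations along a path. A partition of unity on the path space glues
them: each is used during a time interval whose length is its weight. To have such a partition, the
trivializing cover is refined by one pulled back from a metric space `M`; then `C(I, M)` is
metrizable, hence paracompact.

The fiber of a fiberwise join is the join of the fibers, and `e` identifies the fiber of `ξ_0` with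
that of `p_A`. Moving the endpoint along a path of `Z` is a homotopy equivalence, and joins preserve
those.

For a section, the open sets `t ≠ 1` and `t ≠ 0` carry sections of `ξ_0` and `ξ_{k-1}`; induction
reduces to sections of `ξ_0`, which are deformations read backwards. -/

open Topology Filter Set unitInterval

/-! ### The topology of the join -/

namespace TopJoin

variable {A B A' B' Q : Type*}

/-- The join of two maps. -/
@[simps]
def map (f : A → A') (g : B → B') (z : TopJoin A B) : TopJoin A' B' where
  t := z.t
  left := z.left.map f
  right := z.right.map g
  left_isSome := by simpa using z.left_isSome
  right_isSome := by simpa using z.right_isSome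

theorem exists_left {z : TopJoin A B} (h : z.t ≠ 1) : ∃ a, z.left = some a :=
  Option.isSome_iff_exists.1 (z.left_isSome.2 h)

theorem exists_right {z : TopJoin A B} (h : z.t ≠ 0) : ∃ b, z.right = some b :=
  Option.isSome_iff_exists.1 (z.right_isSome.2 h)

theorem left_or_right (z : TopJoin A B) : (∃ a, z.left = some a) ∨ ∃ b, z.right = some b := by
  by_cases h : z.t = 1
  · exact .inr (exists_right (by rw [h]; exact one_ne_zero))
  · exact .inl (exists_left h)

theorem map_id (z : TopJoin A B) : map id id z = z := by
  ext1 <;> simp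

theorem map_map {A'' B'' : Type*} (f : A → A') (g : B → B') (f' : A' → A'') (g' : B' → B'')
    (z : TopJoin A B) : map f' g' (map f g z) = map (f' ∘ f) (g' ∘ g) z := by
  ext1 <;> simp

theorem exists_map_val {p : A → Prop} {q : B → Prop} (z : TopJoin A B)
    (hl : ∀ a, z.left = some a → p a) (hr : ∀ b, z.right = some b → q b) :
    ∃ w : TopJoin {a // p a} {b // q b}, map Subtype.val Subtype.val w = z := by
  refine ⟨⟨z.t, z.left.pmap (fun a ha => ⟨a, ha⟩) hl, z.right.pmap (fun a ha => ⟨a, ha⟩) hr,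
    ?_, ?_⟩, TopJoin.ext rfl ?_ ?_⟩
  · rw [Option.isSome_pmap]
    exact z.left_isSome
  · rw [Option.isSome_pmap]
    exact z.right_isSome
  · exact (Option.map_pmap ..).trans ((Option.pmap_eq_map ..).trans Option.map_id_apply)
  · exact (Option.map_pmap ..).trans ((Option.pmap_eq_map ..).trans Option.map_id_apply)

theorem map_injective {f : A → A'} {g : B → B'} (hf : f.Injective) (hg : g.Injective) :
    (map f g).Injective := by
  intro z z' h
  have h1 := congrArg TopJoin.t h
  have h2 := congrArg TopJoin.left h
  have h3 := congrArg TopJoin.right h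
  exact TopJoin.ext h1 (Option.map_injective hf h2) (Option.map_injective hg h3)

variable [TopologicalSpace A] [TopologicalSpace B] [TopologicalSpace A'] [TopologicalSpace B']

/-- A coordinate imposes a condition only if it is present at the limit. This coarseness is what
makes joins of parametrized families continuous with no compactness assumption. -/
theorem tendsto_nhds_iff {F : Q → TopJoin A B} {l : Filter Q} {z : TopJoin A B} :
    Tendsto F l (𝓝 z) ↔ Tendsto (fun q => (F q).t) l (𝓝 z.t) ∧
      (∀ a, z.left = some a → ∀ V ∈ 𝓝 a, ∀ᶠ q in l, ∃ a' ∈ V, (F q).left = some a') ∧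
      ∀ b, z.right = some b → ∀ V ∈ 𝓝 b, ∀ᶠ q in l, ∃ b' ∈ V, (F q).right = some b' := by
  rw [TopologicalSpace.tendsto_nhds_generateFrom_iff]
  constructor
  · intro h
    refine ⟨tendsto_nhds.2 fun V hV hz => h _ (.inl (.inl ⟨V, hV, rfl⟩)) hz, ?_, ?_⟩
    · intro a ha V hV
      obtain ⟨W, hWV, hW, haW⟩ := mem_nhds_iff.1 hV
      filter_upwards [h _ (.inl (.inr ⟨W, hW, rfl⟩)) ⟨a, haW, ha⟩] with q ⟨a', h1, h2⟩
      exact ⟨a', hWV h1, h2⟩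
    · intro a ha V hV
      obtain ⟨W, hWV, hW, haW⟩ := mem_nhds_iff.1 hV
      filter_upwards [h _ (.inr ⟨W, hW, rfl⟩) ⟨a, haW, ha⟩] with q ⟨a', h1, h2⟩
      exact ⟨a', hWV h1, h2⟩
  · rintro ⟨h1, h2, h3⟩ s ((⟨V, hV, rfl⟩ | ⟨V, hV, rfl⟩) | ⟨V, hV, rfl⟩)
    · exact fun hz => h1 (hV.mem_nhds hz)
    · rintro ⟨a, haV, ha⟩
      exact h2 a ha V (hV.mem_nhds haV)
    · rintro ⟨a, haV, ha⟩
      exact h3 a ha V (hV.mem_nhds haV)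

theorem continuous_t : Continuous (TopJoin.t : TopJoin A B → I) :=
  continuous_iff_continuousAt.2 fun _ => (tendsto_nhds_iff.1 tendsto_id).1

theorem eventually_left {z : TopJoin A B} {a : A} (ha : z.left = some a) :
    ∀ᶠ z' in 𝓝 z, z'.left = some (z'.left.getD a) := by
  filter_upwards [(tendsto_nhds_iff.1 (tendsto_id (x := 𝓝 z))).2.1 a ha univ univ_mem]
    with z' ⟨a', _, h⟩
  simp_all

theorem eventually_right {z : TopJoin A B} {b : B} (hb : z.right = some b) :
    ∀ᶠ z' in 𝓝 z, z'.right = some (z'.right.getD b) := by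
  filter_upwards [(tendsto_nhds_iff.1 (tendsto_id (x := 𝓝 z))).2.2 b hb univ univ_mem]
    with z' ⟨a', _, h⟩
  simp_all

theorem tendsto_left_getD {z : TopJoin A B} {a : A} (ha : z.left = some a) :
    Tendsto (fun z' : TopJoin A B => z'.left.getD a) (𝓝 z) (𝓝 a) := by
  intro V hV
  refine ((tendsto_nhds_iff.1 (tendsto_id (x := 𝓝 z))).2.1 a ha V hV).mono fun z' ⟨a', hV', h⟩ => ?_
  simp_all

theorem tendsto_right_getD {z : TopJoin A B} {b : B} (hb : z.right = some b) :
    Tendsto (fun z' : TopJoin A B => z'.right.getD b) (𝓝 z) (𝓝 b) := by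
  intro V hV
  refine ((tendsto_nhds_iff.1 (tendsto_id (x := 𝓝 z))).2.2 b hb V hV).mono fun z' ⟨a', hV', h⟩ => ?_
  simp_all

theorem tendsto_nhds_of {F : Q → TopJoin A B} {l : Filter Q} {z : TopJoin A B}
    (ht : Tendsto (fun q => (F q).t) l (𝓝 z.t))
    (hl : ∀ a, z.left = some a →
      ∃ g : Q → A, Tendsto g l (𝓝 a) ∧ ∀ᶠ q in l, (F q).left = some (g q))
    (hr : ∀ b, z.right = some b →
      ∃ g : Q → B, Tendsto g l (𝓝 b) ∧ ∀ᶠ q in l, (F q).right = some (g q)) :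
    Tendsto F l (𝓝 z) := by
  refine tendsto_nhds_iff.2 ⟨ht, fun a ha V hV => ?_, fun b hb V hV => ?_⟩
  · obtain ⟨g, hg, h⟩ := hl a ha
    filter_upwards [hg hV, h] with q h1 h2 using ⟨_, h1, h2⟩
  · obtain ⟨g, hg, h⟩ := hr b hb
    filter_upwards [hg hV, h] with q h1 h2 using ⟨_, h1, h2⟩

/-- A family of maps `A → A'` and a family of maps `B → B'` induce a continuous family of maps of
joins. -/
theorem tendsto_map {f : Q → A → A'} {g : Q → B → B'} {F : Q → TopJoin A B} {l : Filter Q}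
    {q₀ : Q} (hF : Tendsto F l (𝓝 (F q₀)))
    (hf : ∀ a, (F q₀).left = some a → ∀ h : Q → A, Tendsto h l (𝓝 a) →
      (∀ᶠ q in l, (F q).left = some (h q)) → Tendsto (fun q => f q (h q)) l (𝓝 (f q₀ a)))
    (hg : ∀ b, (F q₀).right = some b → ∀ h : Q → B, Tendsto h l (𝓝 b) →
      (∀ᶠ q in l, (F q).right = some (h q)) → Tendsto (fun q => g q (h q)) l (𝓝 (g q₀ b))) :
    Tendsto (fun q => map (f q) (g q) (F q)) l (𝓝 (map (f q₀) (g q₀) (F q₀))) := by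
  refine tendsto_nhds_of ((continuous_t.tendsto (F q₀)).comp hF) (fun a' ha' => ?_) fun b' hb' => ?_
  · obtain ⟨a, ha, rfl⟩ := Option.map_eq_some_iff.1 ha'
    have h1 := hF.eventually (eventually_left ha)
    refine ⟨_, hf a ha _ ((tendsto_left_getD ha).comp hF) h1, ?_⟩
    filter_upwards [h1] with q hq
    simp only [map_left, Function.comp_apply]
    rw [hq]
    simp
  · obtain ⟨a, ha, rfl⟩ := Option.map_eq_some_iff.1 hb'
    have h1 := hF.eventually (eventually_right ha)
    refine ⟨_, hg a ha _ ((tendsto_right_getD ha).comp hF) h1, ?_⟩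
    filter_upwards [h1] with q hq
    simp only [map_right, Function.comp_apply]
    rw [hq]
    simp

theorem continuous_map_uncurry [TopologicalSpace Q] {f : Q → A → A'} {g : Q → B → B'}
    (hf : Continuous fun x : Q × A => f x.1 x.2) (hg : Continuous fun x : Q × B => g x.1 x.2) :
    Continuous fun x : Q × TopJoin A B => map (f x.1) (g x.1) x.2 := by
  refine continuous_iff_continuousAt.2 fun x => ?_
  refine tendsto_map (q₀ := x) (l := 𝓝 x) (F := fun x : Q × TopJoin A B => x.2)
    (f := fun x => f x.1) (g := fun x => g x.1) (continuous_snd.tendsto x)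
    (fun a _ h hh _ => ?_) fun a _ h hh _ => ?_
  · exact (hf.tendsto (x.1, a)).comp ((continuous_fst.tendsto x).prodMk_nhds hh)
  · exact (hg.tendsto (x.1, a)).comp ((continuous_fst.tendsto x).prodMk_nhds hh)

theorem continuous_map {f : A → A'} {g : B → B'} (hf : Continuous f) (hg : Continuous g) :
    Continuous (map f g) :=
  (continuous_map_uncurry (Q := Unit) (f := fun _ => f) (g := fun _ => g) (hf.comp continuous_snd)
    (hg.comp continuous_snd)).comp (Continuous.prodMk_right ())

/-- Needed to compare the join of two fibers with a subspace of the join of the total spaces. -/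
theorem isInducing_map {f : A → A'} {g : B → B'} (hf : IsInducing f) (hg : IsInducing g) :
    IsInducing (map f g) := by
  refine isInducing_iff_nhds.2 fun z => le_antisymm
    ((continuous_map hf.continuous hg.continuous).tendsto z).le_comap ?_
  have key := tendsto_nhds_iff.1 (tendsto_comap (f := map f g) (x := 𝓝 (map f g z)))
  refine tendsto_id'.1 (tendsto_nhds_iff.2 ⟨key.1, fun a ha V hV => ?_, fun b hb V hV => ?_⟩)
  · rw [hf.nhds_eq_comap] at hV
    obtain ⟨W, hW, hWV⟩ := hV
    filter_upwards [key.2.1 (f a) (by simp [ha]) W hW] with z' ⟨a', h1, h2⟩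
    obtain ⟨a, ha, rfl⟩ := Option.map_eq_some_iff.1 h2
    exact ⟨a, hWV h1, ha⟩
  · rw [hg.nhds_eq_comap] at hV
    obtain ⟨W, hW, hWV⟩ := hV
    filter_upwards [key.2.2 (g b) (by simp [hb]) W hW] with z' ⟨a', h1, h2⟩
    obtain ⟨a, ha, rfl⟩ := Option.map_eq_some_iff.1 h2
    exact ⟨a, hWV h1, ha⟩

end TopJoin

/-- Homeomorphic spaces have homeomorphic joins. -/
def Homeomorph.topJoin {A B A' B' : Type*} [TopologicalSpace A] [TopologicalSpace B]
    [TopologicalSpace A'] [TopologicalSpace B'] (e : A ≃ₜ A') (e' : B ≃ₜ B') :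
    TopJoin A B ≃ₜ TopJoin A' B' where
  toFun := TopJoin.map e e'
  invFun := TopJoin.map e.symm e'.symm
  left_inv z := by rw [TopJoin.map_map]; simpa using TopJoin.map_id z
  right_inv z := by rw [TopJoin.map_map]; simpa using TopJoin.map_id z
  continuous_toFun := TopJoin.continuous_map e.continuous e'.continuous
  continuous_invFun := TopJoin.continuous_map e.symm.continuous e'.symm.continuous

/-- The join of two continuous maps. -/
def ContinuousMap.topJoin {A B A' B' : Type*} [TopologicalSpace A] [TopologicalSpace B]
    [TopologicalSpace A'] [TopologicalSpace B'] (f : C(A, A')) (g : C(B, B')) :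
    C(TopJoin A B, TopJoin A' B') :=
  ⟨TopJoin.map f g, TopJoin.continuous_map f.continuous g.continuous⟩

theorem ContinuousMap.Homotopic.topJoin {A B A' B' : Type*} [TopologicalSpace A]
    [TopologicalSpace B] [TopologicalSpace A'] [TopologicalSpace B'] {f f' : C(A, A')}
    {g g' : C(B, B')} (hf : f.Homotopic f') (hg : g.Homotopic g') :
    (f.topJoin g).Homotopic (f'.topJoin g') := by
  obtain ⟨F⟩ := hf
  obtain ⟨G⟩ := hg
  exact ⟨{
    toFun := fun x => TopJoin.map (fun a => F (x.1, a)) (fun b => G (x.1, b)) x.2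
    continuous_toFun := TopJoin.continuous_map_uncurry (f := fun s a => F (s, a))
      (g := fun s b => G (s, b)) F.continuous G.continuous
    map_zero_left := fun z => by simp [ContinuousMap.topJoin]
    map_one_left := fun z => by simp [ContinuousMap.topJoin] }⟩

/-- Homotopy equivalent spaces have homotopy equivalent joins. -/
def ContinuousMap.HomotopyEquiv.topJoin {A B A' B' : Type*} [TopologicalSpace A]
    [TopologicalSpace B] [TopologicalSpace A'] [TopologicalSpace B']
    (e : ContinuousMap.HomotopyEquiv A A') (e' : ContinuousMap.HomotopyEquiv B B') :
    ContinuousMap.HomotopyEquiv (TopJoin A B) (TopJoin A' B') where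
  toFun := e.toFun.topJoin e'.toFun
  invFun := e.invFun.topJoin e'.invFun
  left_inv := by
    convert e.left_inv.topJoin e'.left_inv using 1
    · ext1 z; exact TopJoin.map_map ..
    · ext1 z; exact (TopJoin.map_id z).symm
  right_inv := by
    convert e.right_inv.topJoin e'.right_inv using 1
    · ext1 z; exact TopJoin.map_map ..
    · ext1 z; exact (TopJoin.map_id z).symm

/-! ### Path lifting functions -/

/-- `p` is continuous and admits a path lifting function: every path `γ` in `B` and every point `e`
over `γ 0` yield a lift of `γ` starting at `e` which depends continuously on `(e, γ)`. -/
def HasPathLifting {E : Type*} {B : Type*} [TopologicalSpace E] [TopologicalSpace B]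
    (p : E → B) : Prop :=
  Continuous p ∧ ∃ Λ : E → C(I, B) → I → E,
    ContinuousOn (fun q : E × C(I, B) × I => Λ q.1 q.2.1 q.2.2) {q | p q.1 = q.2.1 0} ∧
    ∀ e γ, p e = γ 0 → Λ e γ 0 = e ∧ ∀ t, p (Λ e γ t) = γ t

/-- Currying a homotopy gives a continuous family of paths for every `W`, so one path lifting
function serves all homotopy lifting problems. -/
theorem HasPathLifting.isHurewiczFibration {E : Type u} {B : Type v} [TopologicalSpace E]
    [TopologicalSpace B] {p : E → B} (hp : HasPathLifting p) :
    IsHurewiczFibration.{u, v, w} p := by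
  obtain ⟨hc, Λ, hΛ, h⟩ := hp
  refine ⟨hc, fun W _ h' g hg => ⟨⟨fun x => Λ (g x.1) (h'.curry x.1) x.2, ?_⟩, ?_, ?_⟩⟩
  · refine hΛ.comp_continuous (f := fun x : W × I => (g x.1, h'.curry x.1, x.2)) ?_ ?_
    · fun_prop
    · intro x
      simp [hg]
  · intro x
    exact (h _ _ (by simp [hg])).1
  · intro x
    exact (h (g x.1) (h'.curry x.1) (by simp [hg])).2 x.2

/-! ### Fiberwise joins -/

namespace SpaceOver

variable {X : Type u} (E E' : SpaceOver X)

/-- At the ends `t = 0, 1` one coordinate is forgotten, but the point must still lie on some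
interval; hence both fibers over `x` have to be nonempty. -/
theorem exists_fiberJoin_proj_iff {z : TopJoin E.total E'.total} {x : X} :
    (∃ h, (E.fiberJoin E').proj ⟨z, h⟩ = x) ↔ (∃ a, E.proj a = x) ∧ (∃ b, E'.proj b = x) ∧
      (∀ a, z.left = some a → E.proj a = x) ∧ ∀ b, z.right = some b → E'.proj b = x := by
  constructor
  · rintro ⟨⟨a, b, hab, t, rfl⟩, h⟩
    have hx : E.proj a = x := by rw [← h]; exact (TopJoin.elim_seg _ _ hab t).symm
    refine ⟨⟨a, hx⟩, ⟨b, hab ▸ hx⟩, fun a' h' => ?_, fun b' h' => ?_⟩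
    · simp only [TopJoin.seg] at h'
      split_ifs at h'
      cases h'
      exact hx
    · simp only [TopJoin.seg] at h'
      split_ifs at h'
      simp_all
  · rintro ⟨⟨a, ha⟩, ⟨b, hb⟩, hl, hr⟩
    have key : ∃ a b, E.proj a = x ∧ E'.proj b = x ∧ z = TopJoin.seg a b z.t := by
      -- A forgotten coordinate is replaced by an arbitrary point of the fiber over `x`.
      refine ⟨z.left.getD a, z.right.getD b, ?_, ?_, ?_⟩
      · cases h : z.left with
        | none => exact ha
        | some a' => exact hl _ h
      · cases h : z.right with
        | none => exact hb
        | some a' => exact hr _ h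
      · refine TopJoin.ext rfl ?_ ?_
        · simp only [TopJoin.seg]
          split_ifs with h
          · have := z.left_isSome
            simpa [h] using this
          · obtain ⟨a', h'⟩ := TopJoin.exists_left h
            simp [h']
        · simp only [TopJoin.seg]
          split_ifs with h
          · have := z.right_isSome
            simpa [h] using this
          · obtain ⟨a', h'⟩ := TopJoin.exists_right h
            simp [h']
    obtain ⟨a, b, ha, hb, hz⟩ := key
    refine ⟨⟨a, b, ha.trans hb.symm, z.t, hz⟩, ?_⟩
    change TopJoin.elim E.proj E'.proj z = x
    rw [hz, TopJoin.elim_seg _ _ (ha.trans hb.symm), ha]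

variable {E E'}

theorem proj_left (z : (E.fiberJoin E').total) {a : E.total} (h : z.1.left = some a) :
    E.proj a = (E.fiberJoin E').proj z :=
  ((exists_fiberJoin_proj_iff E E').1 ⟨z.2, rfl⟩).2.2.1 a h

theorem proj_right (z : (E.fiberJoin E').total) {b : E'.total} (h : z.1.right = some b) :
    E'.proj b = (E.fiberJoin E').proj z :=
  ((exists_fiberJoin_proj_iff E E').1 ⟨z.2, rfl⟩).2.2.2 b h

theorem continuous_fiberJoin_proj [TopologicalSpace X] (hE : Continuous E.proj)
    (hE' : Continuous E'.proj) : Continuous (E.fiberJoin E').proj := by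
  refine continuous_iff_continuousAt.2 fun z => ?_
  have hv : Tendsto Subtype.val (𝓝 z) (𝓝 z.1) := continuous_subtype_val.tendsto z
  rcases z.1.left_or_right with ⟨a, ha⟩ | ⟨b, hb⟩
  · have h := (hE.tendsto a).comp ((TopJoin.tendsto_left_getD ha).comp hv)
    rw [proj_left z ha] at h
    refine h.congr' ?_
    filter_upwards [hv.eventually (TopJoin.eventually_left ha)] with z' hz'
    exact proj_left z' hz'
  · have h := (hE'.tendsto b).comp ((TopJoin.tendsto_right_getD hb).comp hv)
    rw [proj_right z hb] at h
    refine h.congr' ?_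
    filter_upwards [hv.eventually (TopJoin.eventually_right hb)] with z' hz'
    exact proj_right z' hz'

open Classical in
theorem hasPathLifting_fiberJoin [TopologicalSpace X] (hE : HasPathLifting E.proj)
    (hE' : HasPathLifting E'.proj) : HasPathLifting (E.fiberJoin E').proj := by
  obtain ⟨hp, Λ, hΛ, h⟩ := hE
  obtain ⟨hp', Λ', hΛ', h'⟩ := hE'
  have key : ∀ (z : (E.fiberJoin E').total) (γ : C(I, X)), (E.fiberJoin E').proj z = γ 0 → ∀ t,
      ∃ hz, (E.fiberJoin E').proj ⟨z.1.map (Λ · γ t) (Λ' · γ t), hz⟩ = γ t := by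
    intro z γ hz t
    obtain ⟨⟨a, ha⟩, ⟨b, hb⟩, hl, hr⟩ := (exists_fiberJoin_proj_iff E E').1 ⟨z.2, hz⟩
    refine (exists_fiberJoin_proj_iff E E').2 ⟨⟨_, (h a γ ha).2 t⟩, ⟨_, (h' b γ hb).2 t⟩, ?_, ?_⟩
    · intro a' ha'
      obtain ⟨a, ha, rfl⟩ := Option.map_eq_some_iff.1 ha'
      exact (h a γ (hl a ha)).2 t
    · intro a' ha'
      obtain ⟨a, ha, rfl⟩ := Option.map_eq_some_iff.1 ha'
      exact (h' a γ (hr a ha)).2 t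
  let L : (E.fiberJoin E').total → C(I, X) → I → (E.fiberJoin E').total := fun z γ t =>
    if hz : (E.fiberJoin E').proj z = γ 0 then ⟨_, (key z γ hz t).1⟩ else z
  have hL : ∀ z γ (hz : (E.fiberJoin E').proj z = γ 0) t, L z γ t = ⟨_, (key z γ hz t).1⟩ :=
    fun z γ hz t => dif_pos hz
  refine ⟨continuous_fiberJoin_proj hp hp', L, ?_, ?_⟩
  · refine (IsInducing.subtypeVal (t := {z : TopJoin E.total E'.total |
      ∃ a b, E.proj a = E'.proj b ∧ ∃ t, z = TopJoin.seg a b t})).continuousOn_iff.2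
      (ContinuousOn.congr (f := fun
      q : (E.fiberJoin E').total × C(I, X) × I => q.1.1.map (Λ · q.2.1 q.2.2) (Λ' · q.2.1 q.2.2))
      ?_ ?_)
    · intro q hq
      have hF : Tendsto (fun q : (E.fiberJoin E').total × C(I, X) × I => q.1.1)
          (𝓝[{q | (E.fiberJoin E').proj q.1 = q.2.1 0}] q) (𝓝 q.1.1) :=
        ((continuous_subtype_val.tendsto q.1).comp
          (continuous_fst.tendsto q)).mono_left nhdsWithin_le_nhds
      refine TopJoin.tendsto_map (q₀ := q) (f := fun q => (Λ · q.2.1 q.2.2))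
        (g := fun q => (Λ' · q.2.1 q.2.2)) hF ?_ ?_
      · intro a ha g hg hg'
        refine (hΛ (a, q.2) ((proj_left q.1 ha).trans hq)).tendsto.comp
          (f := fun q' => (g q', q'.2)) (tendsto_nhdsWithin_iff.2 ⟨?_, ?_⟩)
        · exact hg.prodMk_nhds continuous_snd.continuousWithinAt
        · filter_upwards [hg', self_mem_nhdsWithin] with q' h1 h2
          exact (proj_left q'.1 h1).trans h2
      · intro a ha g hg hg'
        refine (hΛ' (a, q.2) ((proj_right q.1 ha).trans hq)).tendsto.comp
          (f := fun q' => (g q', q'.2)) (tendsto_nhdsWithin_iff.2 ⟨?_, ?_⟩)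
        · exact hg.prodMk_nhds continuous_snd.continuousWithinAt
        · filter_upwards [hg', self_mem_nhdsWithin] with q' h1 h2
          exact (proj_right q'.1 h1).trans h2
    · exact fun q hq => congrArg Subtype.val (hL q.1 q.2.1 hq q.2.2)
  · intro z γ hz
    simp only [hL z γ hz]
    refine ⟨Subtype.ext (TopJoin.ext rfl ?_ ?_), fun t => (key z γ hz t).2⟩
    · change z.1.left.map _ = z.1.left
      cases hl : z.1.left with
      | none => rfl
      | some a => simp [(h a γ ((proj_left z hl).trans hz)).1]
    · change z.1.right.map _ = z.1.right
      cases hl : z.1.right with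
      | none => rfl
      | some a => simp [(h' a γ ((proj_right z hl).trans hz)).1]

/-- The fibers of the fiberwise join are the joins of the fibers. -/
theorem nonempty_fiberJoin_fiber_homeomorph (x : X)
    (h : (∃ a, E.proj a = x) ↔ ∃ b, E'.proj b = x) :
    Nonempty (TopJoin (E.proj ⁻¹' {x}) (E'.proj ⁻¹' {x}) ≃ₜ (E.fiberJoin E').proj ⁻¹' {x}) := by
  have key : ∀ z : TopJoin (E.proj ⁻¹' {x}) (E'.proj ⁻¹' {x}), ∃ hz,
      (E.fiberJoin E').proj ⟨z.map Subtype.val Subtype.val, hz⟩ = x := by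
    intro z
    have hx : (∃ a, E.proj a = x) ∧ ∃ b, E'.proj b = x := by
      rcases z.left_or_right with ⟨a, -⟩ | ⟨b, -⟩
      · exact ⟨⟨a, a.2⟩, h.1 ⟨a, a.2⟩⟩
      · exact ⟨h.2 ⟨b, b.2⟩, ⟨b, b.2⟩⟩
    refine (exists_fiberJoin_proj_iff E E').2 ⟨hx.1, hx.2, ?_, ?_⟩
    · intro a' ha'
      obtain ⟨a, ha, rfl⟩ := Option.map_eq_some_iff.1 ha'
      exact a.2
    · intro a' ha'
      obtain ⟨a, ha, rfl⟩ := Option.map_eq_some_iff.1 ha'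
      exact a.2
  let F : TopJoin (E.proj ⁻¹' {x}) (E'.proj ⁻¹' {x}) → (E.fiberJoin E').proj ⁻¹' {x} :=
    fun z => ⟨⟨_, (key z).1⟩, (key z).2⟩
  have hind : IsInducing F := by
    have h : IsInducing fun y : (E.fiberJoin E').proj ⁻¹' {x} => y.1.1 :=
      (IsInducing.subtypeVal (t := {z : TopJoin E.total E'.total |
        ∃ a b, E.proj a = E'.proj b ∧ ∃ t, z = TopJoin.seg a b t})).comp IsInducing.subtypeVal
    exact h.of_comp_iff.1 (TopJoin.isInducing_map IsInducing.subtypeVal IsInducing.subtypeVal)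
  have hinj : F.Injective := fun z z' hzz =>
    TopJoin.map_injective Subtype.val_injective Subtype.val_injective
      (congrArg (fun y => y.1.1) hzz)
  have hsurj : F.Surjective := by
    intro z
    have hl : ∀ a, z.1.1.left = some a → E.proj a = x := fun a ha =>
      (proj_left z.1 ha).trans z.2
    have hr : ∀ a, z.1.1.right = some a → E'.proj a = x := fun a ha =>
      (proj_right z.1 ha).trans z.2
    obtain ⟨w, hw⟩ := TopJoin.exists_map_val z.1.1 hl hr
    exact ⟨w, Subtype.ext (Subtype.ext hw)⟩
  exact ⟨(Equiv.ofBijective F ⟨hinj, hsurj⟩).toHomeomorphOfIsInducing hind⟩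

end SpaceOver

/-! ### Parallel transport in stratified bundles -/

/-- A point outside `C` is not in the closure of `D ∩ C`, so that piece imposes no condition there;
`D` itself need not be closed. -/
theorem continuousOn_of_isClosed_cover {P Q : Type*} [TopologicalSpace P] [TopologicalSpace Q]
    {g : P → Q} {D C C' : Set P} (hC : IsClosed C) (hC' : IsClosed C') (hD : D ⊆ C ∪ C')
    (h : ContinuousOn g (D ∩ C)) (h' : ContinuousOn g (D ∩ C')) : ContinuousOn g D := by
  have key : ∀ {C : Set P}, IsClosed C → ContinuousOn g (D ∩ C) →
      ∀ q ∈ D, ContinuousWithinAt g (D ∩ C) q := by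
    intro C hC h q hq
    by_cases hqC : q ∈ C
    · exact h q ⟨hq, hqC⟩
    · exact continuousWithinAt_of_notMem_closure fun hcl =>
        hqC (hC.closure_subset_iff.2 inter_subset_right hcl)
  intro q hq
  refine ((key hC h q hq).union (key hC' h' q hq)).mono fun q hq => ?_
  rcases hD hq with h | h
  exacts [.inl ⟨hq, h⟩, .inr ⟨hq, h⟩]

/-- `Λ x β a b` is the result of a parallel transport of the point `x` over `β a` along the path `β`
from time `a` to time `b`, for all `(β, a, b) ∈ S`. It depends continuously on all data, is trivial
if `a = b`, and preserves `X'`. -/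
structure IsTransport {X : Type u} {Y : Type v} [TopologicalSpace X] [TopologicalSpace Y]
    (f : X → Y) (X' : Set X) (S : Set (C(I, Y) × I × I)) (Λ : X → C(I, Y) → I → I → X) :
    Prop where
  continuousOn : ContinuousOn (fun q : X × C(I, Y) × I × I => Λ q.1 q.2.1 q.2.2.1 q.2.2.2)
    {q | q.2 ∈ S ∧ f q.1 = q.2.1 q.2.2.1}
  proj : ∀ {x β a b}, (β, a, b) ∈ S → f x = β a → f (Λ x β a b) = β b
  refl : ∀ {x β a}, (β, a, a) ∈ S → f x = β a → Λ x β a a = x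
  mem : ∀ {x β a b}, (β, a, b) ∈ S → f x = β a → x ∈ X' → Λ x β a b ∈ X'

variable {X : Type u} {Y : Type v} [TopologicalSpace X] [TopologicalSpace Y] {f : X → Y}
  {X' : Set X}

theorem IsTransport.mono {S S' : Set (C(I, Y) × I × I)} {Λ : X → C(I, Y) → I → I → X}
    (h : IsTransport f X' S Λ) (hS : S' ⊆ S) : IsTransport f X' S' Λ where
  continuousOn := h.continuousOn.mono fun _ hq => ⟨hS hq.1, hq.2⟩
  proj h' := h.proj (hS h')
  refl h' := h.refl (hS h')
  mem h' := h.mem (hS h')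

open Classical in
-- In the chart `Z × U` the first coordinate is kept and the second replaced by `β b`.
theorem exists_isTransport_of_trivialization {Z : Type*} [TopologicalSpace Z] {A : Set Z}
    {U : Set Y} (e : (f ⁻¹' U) ≃ₜ Z × U) (he : ∀ x, ((e x).2 : Y) = f x)
    (heA : ∀ x, (e x).1 ∈ A ↔ (x : X) ∈ X') :
    ∃ Λ, IsTransport f X' {q | q.1 q.2.1 ∈ U ∧ q.1 q.2.2 ∈ U} Λ := by
  let Λ : X → C(I, Y) → I → I → X := fun x β a b =>
    if h : f x ∈ U ∧ β b ∈ U then e.symm ((e ⟨x, h.1⟩).1, ⟨β b, h.2⟩) else x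
  have hΛ : ∀ {x β b} (a : I) (h : f x ∈ U ∧ β b ∈ U),
      Λ x β a b = e.symm ((e ⟨x, h.1⟩).1, ⟨β b, h.2⟩) := fun _ h => dif_pos h
  refine ⟨Λ, ?_, ?_, ?_, ?_⟩
  · rw [continuousOn_iff_continuous_domRestrict]
    let T := {q : X × C(I, Y) × I × I |
      q.2 ∈ {q : C(I, Y) × I × I | q.1 q.2.1 ∈ U ∧ q.1 q.2.2 ∈ U} ∧ f q.1 = q.2.1 q.2.2.1}
    have hT : ∀ q : T, f q.1.1 ∈ U ∧ q.1.2.1 q.1.2.2.2 ∈ U := fun q =>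
      ⟨by rw [q.2.2]; exact q.2.1.1, q.2.1.2⟩
    have h : Continuous fun q : T =>
        (e.symm ((e ⟨q.1.1, (hT q).1⟩).1, ⟨q.1.2.1 q.1.2.2.2, (hT q).2⟩) : X) := by
      refine continuous_subtype_val.comp (e.symm.continuous.comp (Continuous.prodMk ?_ ?_))
      · refine continuous_fst.comp (e.continuous.comp (Continuous.subtype_mk ?_ _))
        fun_prop
      · refine Continuous.subtype_mk ?_ _
        fun_prop
    exact h.congr fun q => (hΛ q.1.2.2.1 (hT q)).symm
  · rintro x β a b ⟨ha, hb⟩ hx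
    rw [hΛ a ⟨by rwa [hx], hb⟩, ← he, Homeomorph.apply_symm_apply]
  · rintro x β a ⟨ha, hb⟩ hx
    have h : f x ∈ U := by rwa [hx]
    rw [hΛ a ⟨h, hb⟩]
    have : ((e ⟨x, h⟩).1, (⟨β a, hb⟩ : U)) = e ⟨x, h⟩ :=
      Prod.ext rfl (Subtype.ext ((he ⟨x, h⟩).trans hx).symm)
    rw [this, Homeomorph.symm_apply_apply]
  · rintro x β a b ⟨ha, hb⟩ hx hxX
    have h : f x ∈ U := by rwa [hx]
    rw [hΛ a ⟨h, hb⟩, ← heA, Homeomorph.apply_symm_apply, heA]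
    exact hxX

/-- Transport by `Λ₁` before time `c` and by `Λ₂` afterwards. The regions `b ≤ c`, `c ≤ a` and `a ≤
c ≤ b` are closed, and the three formulas agree on overlaps because transport over a degenerate
interval is trivial. -/
theorem IsTransport.exists_trans {V V' : Set C(I, Y)} {c c' : I}
    {Λ₁ Λ₂ : X → C(I, Y) → I → I → X}
    (h₁ : IsTransport f X' {q | q.1 ∈ V ∧ q.2.1 ≤ q.2.2 ∧ q.2.2 ≤ c} Λ₁)
    (h₂ : IsTransport f X' {q | q.1 ∈ V' ∧ c ≤ q.2.1 ∧ q.2.1 ≤ q.2.2 ∧ q.2.2 ≤ c'} Λ₂) :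
    ∃ Λ, IsTransport f X' {q | q.1 ∈ V ∩ V' ∧ q.2.1 ≤ q.2.2 ∧ q.2.2 ≤ c'} Λ := by
  let Λ : X → C(I, Y) → I → I → X := fun x β a b =>
    if b ≤ c then Λ₁ x β a b else if c ≤ a then Λ₂ x β a b else Λ₂ (Λ₁ x β a c) β c b
  have hΛ₁ : ∀ {x β a b}, b ≤ c → Λ x β a b = Λ₁ x β a b := fun h => if_pos h
  have hΛ₂ : ∀ {x β a b}, β ∈ V → β ∈ V' → f x = β a → a ≤ b → b ≤ c' → c ≤ a →
      Λ x β a b = Λ₂ x β a b := by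
    intro x β a b hV hV' hx hab hb ha
    by_cases hbc : b ≤ c
    · obtain rfl : a = b := le_antisymm hab (hbc.trans ha)
      obtain rfl : a = c := le_antisymm hbc ha
      rw [hΛ₁ hbc, h₁.refl ⟨hV, le_rfl, le_rfl⟩ hx, h₂.refl ⟨hV', le_rfl, le_rfl, hb⟩ hx]
    · simp [Λ, hbc, ha]
  have hΛ₃ : ∀ {x β a b}, β ∈ V → β ∈ V' → f x = β a → a ≤ c → c ≤ b → b ≤ c' →
      Λ x β a b = Λ₂ (Λ₁ x β a c) β c b := by
    intro x β a b hV hV' hx hac hcb hb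
    have hx' : f (Λ₁ x β a c) = β c := h₁.proj ⟨hV, hac, le_rfl⟩ hx
    by_cases hbc : b ≤ c
    · obtain rfl : b = c := le_antisymm hbc hcb
      rw [hΛ₁ hbc, h₂.refl ⟨hV', le_rfl, le_rfl, hb⟩ hx']
    · by_cases hca : c ≤ a
      · obtain rfl : a = c := le_antisymm hac hca
        rw [hΛ₂ hV hV' hx hcb hb hca, h₁.refl ⟨hV, le_rfl, le_rfl⟩ hx]
      · simp [Λ, hbc, hca]
  have hmem : ∀ {a b : I}, a ≤ b → b ≤ c ∨ c ≤ a ∨ (a ≤ c ∧ c ≤ b) := by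
    intro a b hab
    rcases le_total b c with h | h
    · exact .inl h
    · rcases le_total c a with h' | h'
      exacts [.inr (.inl h'), .inr (.inr ⟨h', h⟩)]
  refine ⟨Λ, ?_, ?_, ?_, ?_⟩
  · have ca : Continuous fun q : X × C(I, Y) × I × I => q.2.2.1 := by fun_prop
    have cb : Continuous fun q : X × C(I, Y) × I × I => q.2.2.2 := by fun_prop
    refine continuousOn_of_isClosed_cover (isClosed_le cb (continuous_const (y := c)))
      ((isClosed_le (continuous_const (y := c)) ca).union
        ((isClosed_le ca (continuous_const (y := c))).inter
          (isClosed_le (continuous_const (y := c)) cb)))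
      (fun q hq => hmem hq.1.2.1) ?_ ?_
    · refine ContinuousOn.congr (h₁.continuousOn.mono ?_) fun q hq => hΛ₁ hq.2
      exact fun q hq => ⟨⟨hq.1.1.1.1, hq.1.1.2.1, hq.2⟩, hq.1.2⟩
    · refine continuousOn_of_isClosed_cover (isClosed_le (continuous_const (y := c)) ca)
        ((isClosed_le ca (continuous_const (y := c))).inter
          (isClosed_le (continuous_const (y := c)) cb)) inter_subset_right ?_ ?_
      · refine ContinuousOn.congr (h₂.continuousOn.mono ?_) fun q hq =>
          hΛ₂ hq.1.1.1.1.1 hq.1.1.1.1.2 hq.1.1.2 hq.1.1.1.2.1 hq.1.1.1.2.2 hq.2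
        exact fun q hq => ⟨⟨hq.1.1.1.1.2, hq.2, hq.1.1.1.2.1, hq.1.1.1.2.2⟩, hq.1.1.2⟩
      · refine ContinuousOn.congr (f := fun q : X × C(I, Y) × I × I =>
          Λ₂ (Λ₁ q.1 q.2.1 q.2.2.1 c) q.2.1 c q.2.2.2) ?_ fun q hq =>
          hΛ₃ hq.1.1.1.1.1 hq.1.1.1.1.2 hq.1.1.2 hq.2.1 hq.2.2 hq.1.1.1.2.2
        refine h₂.continuousOn.comp (f := fun q : X × C(I, Y) × I × I =>
          (Λ₁ q.1 q.2.1 q.2.2.1 c, q.2.1, c, q.2.2.2)) (ContinuousOn.prodMk ?_ (by fun_prop)) ?_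
        · refine h₁.continuousOn.comp (f := fun q : X × C(I, Y) × I × I =>
            (q.1, q.2.1, q.2.2.1, c)) (by fun_prop) ?_
          exact fun q hq => ⟨⟨hq.1.1.1.1.1, hq.2.1, le_rfl⟩, hq.1.1.2⟩
        · exact fun q hq => ⟨⟨hq.1.1.1.1.2, le_rfl, hq.2.2, hq.1.1.1.2.2⟩,
            h₁.proj ⟨hq.1.1.1.1.1, hq.2.1, le_rfl⟩ hq.1.1.2⟩
  · rintro x β a b ⟨⟨hV, hV'⟩, hab, hb⟩ hx
    rcases hmem hab with h | h | ⟨h, h'⟩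
    · rw [hΛ₁ h]
      exact h₁.proj ⟨hV, hab, h⟩ hx
    · rw [hΛ₂ hV hV' hx hab hb h]
      exact h₂.proj ⟨hV', h, hab, hb⟩ hx
    · rw [hΛ₃ hV hV' hx h h' hb]
      exact h₂.proj ⟨hV', le_rfl, h', hb⟩ (h₁.proj ⟨hV, h, le_rfl⟩ hx)
  · rintro x β a ⟨⟨hV, hV'⟩, hab, hb⟩ hx
    rcases le_total a c with h | h
    · rw [hΛ₁ h]
      exact h₁.refl ⟨hV, hab, h⟩ hx
    · rw [hΛ₂ hV hV' hx hab hb h]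
      exact h₂.refl ⟨hV', h, hab, hb⟩ hx
  · rintro x β a b ⟨⟨hV, hV'⟩, hab, hb⟩ hx hxX
    rcases hmem hab with h | h | ⟨h, h'⟩
    · rw [hΛ₁ h]
      exact h₁.mem ⟨hV, hab, h⟩ hx hxX
    · rw [hΛ₂ hV hV' hx hab hb h]
      exact h₂.mem ⟨hV', h, hab, hb⟩ hx hxX
    · rw [hΛ₃ hV hV' hx h h' hb]
      exact h₂.mem ⟨hV', le_rfl, h', hb⟩ (h₁.proj ⟨hV, h, le_rfl⟩ hx)
        (h₁.mem ⟨hV, h, le_rfl⟩ hx hxX)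

/-! #### Gluing of transports -/

/-- Transport along `β` up to time `t`, successively for each index `j` of a list, by means of
`Λ j` during a time interval of length `r j β`, starting at time `c`. -/
noncomputable def foldTransport {ι : Type*} (r : ι → C(I, Y) → ℝ)
    (Λ : ι → X → C(I, Y) → I → I → X) : List ι → X → ℝ → C(I, Y) → I → X
  | [], x, _, _, _ => x
  | j :: L, x, c, β, t => foldTransport r Λ L
      (Λ j x β (min t (projIcc 0 1 zero_le_one c)) (min t (projIcc 0 1 zero_le_one (c + r j β))))
      (c + r j β) β t

section foldTransport

variable {ι : Type*} {r : ι → C(I, Y) → ℝ} {Λ : ι → X → C(I, Y) → I → I → X} {W : ι → Set C(I, Y)}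

theorem min_projIcc_le_min {t : I} {c d : ℝ} (h : 0 ≤ d) :
    min t (projIcc 0 1 zero_le_one c) ≤ min t (projIcc 0 1 zero_le_one (c + d)) :=
  min_le_min_left _ (monotone_projIcc _ (le_add_of_nonneg_right h))

theorem foldTransport_spec (hr : ∀ j β, 0 ≤ r j β)
    (hΛ : ∀ j, IsTransport f X' {q | q.1 ∈ W j ∧ q.2.1 ≤ q.2.2} (Λ j)) (L : List ι) {x : X} {c : ℝ}
    {β : C(I, Y)} {t : I} (hβ : ∀ j ∈ L, β ∈ W j)
    (hx : f x = β (min t (projIcc 0 1 zero_le_one c))) :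
    f (foldTransport r Λ L x c β t) =
        β (min t (projIcc 0 1 zero_le_one (c + (L.map (r · β)).sum))) ∧
      (x ∈ X' → foldTransport r Λ L x c β t ∈ X') ∧
      (t = 0 → foldTransport r Λ L x c β t = x) := by
  induction L generalizing x c with
  | nil => simp [foldTransport, hx]
  | cons j L ih =>
    have hS : (β, min t (projIcc 0 1 zero_le_one c),
        min t (projIcc 0 1 zero_le_one (c + r j β))) ∈
        {q : C(I, Y) × I × I | q.1 ∈ W j ∧ q.2.1 ≤ q.2.2} :=
      ⟨hβ j (by simp), min_projIcc_le_min (hr j β)⟩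
    obtain ⟨h1, h2, h3⟩ := ih (fun j hj => hβ j (by simp [hj])) ((hΛ j).proj hS hx)
    refine ⟨?_, fun hxX => h2 ((hΛ j).mem hS hx hxX), fun ht => (h3 ht).trans ?_⟩
    · simp only [foldTransport, h1, List.map_cons, List.sum_cons, add_assoc]
    · have h0 : ∀ s : I, min t s = 0 := fun s => by rw [ht]; exact min_eq_left s.2.1
      rw [h0] at hx
      rw [h0, h0]
      exact (hΛ j).refl ⟨hβ j (by simp), le_rfl⟩ hx

/-- An index of weight zero acts during an interval of length zero, hence trivially. This allows a
list varying with `β` to be replaced locally by a fixed one. -/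
theorem foldTransport_filter (hr : ∀ j β, 0 ≤ r j β)
    (hΛ : ∀ j, IsTransport f X' {q | q.1 ∈ W j ∧ q.2.1 ≤ q.2.2} (Λ j)) (p : ι → Bool) (L : List ι)
    {x : X} {c : ℝ} {β : C(I, Y)} {t : I} (hβ : ∀ j ∈ L, β ∈ W j)
    (hp : ∀ j ∈ L, p j = false → r j β = 0)
    (hx : f x = β (min t (projIcc 0 1 zero_le_one c))) :
    foldTransport r Λ (L.filter p) x c β t = foldTransport r Λ L x c β t := by
  induction L generalizing x c with
  | nil => simp
  | cons j L ih =>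
    have hj := hβ j (by simp)
    cases hpj : p j with
    | true =>
      rw [List.filter_cons_of_pos hpj]
      exact ih (fun j hj => hβ j (by simp [hj])) (fun j hj => hp j (by simp [hj]))
        ((hΛ j).proj ⟨hj, min_projIcc_le_min (hr j β)⟩ hx)
    | false =>
      have h0 := hp j (by simp) hpj
      rw [List.filter_cons_of_neg (by simp [hpj])]
      have : foldTransport r Λ (j :: L) x c β t = foldTransport r Λ L x c β t := by
        rw [foldTransport, h0, add_zero, (hΛ j).refl ⟨hj, le_rfl⟩ hx]
      rw [this]
      exact ih (fun j hj => hβ j (by simp [hj])) (fun j hj => hp j (by simp [hj])) hx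

theorem continuousOn_foldTransport (hr : ∀ j β, 0 ≤ r j β) (hrc : ∀ j, Continuous (r j))
    (hΛ : ∀ j, IsTransport f X' {q | q.1 ∈ W j ∧ q.2.1 ≤ q.2.2} (Λ j)) (L : List ι)
    {P : Set C(I, Y)} (hP : ∀ j ∈ L, P ⊆ W j) :
    ContinuousOn (fun q : X × ℝ × C(I, Y) × I => foldTransport r Λ L q.1 q.2.1 q.2.2.1 q.2.2.2)
      {q | q.2.2.1 ∈ P ∧ f q.1 = q.2.2.1 (min q.2.2.2 (projIcc 0 1 zero_le_one q.2.1))} := by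
  induction L with
  | nil => exact continuousOn_fst
  | cons j L ih =>
    have hc : Continuous fun q : X × ℝ × C(I, Y) × I => q.2.1 + r j q.2.2.1 := by
      have := hrc j
      fun_prop
    have hpr : Continuous (projIcc (0 : ℝ) 1 zero_le_one) := continuous_projIcc
    refine (ih fun j hj => hP j (by simp [hj])).comp (f := fun q : X × ℝ × C(I, Y) × I =>
      (Λ j q.1 q.2.2.1 (min q.2.2.2 (projIcc 0 1 zero_le_one q.2.1))
        (min q.2.2.2 (projIcc 0 1 zero_le_one (q.2.1 + r j q.2.2.1))),
        q.2.1 + r j q.2.2.1, q.2.2.1, q.2.2.2))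
      (ContinuousOn.prodMk ?_ (by fun_prop)) ?_
    · refine (hΛ j).continuousOn.comp (f := fun q : X × ℝ × C(I, Y) × I =>
        (q.1, q.2.2.1, min q.2.2.2 (projIcc 0 1 zero_le_one q.2.1),
          min q.2.2.2 (projIcc 0 1 zero_le_one (q.2.1 + r j q.2.2.1)))) ?_ ?_
      · refine Continuous.continuousOn ?_
        fun_prop
      · exact fun q hq => ⟨⟨hP j (by simp) hq.1, min_projIcc_le_min (hr _ _)⟩, hq.2⟩
    · exact fun q hq => ⟨hq.1,
        (hΛ j).proj ⟨hP j (by simp) hq.1, min_projIcc_le_min (hr _ _)⟩ hq.2⟩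

end foldTransport

/-- Local transports, defined over the members of a numerable cover of the space of paths in the
base, can be glued to a global transport. -/
theorem exists_transport_of_partitionOfUnity {ι N : Type*} [LinearOrder ι] [TopologicalSpace N]
    {G : C(I, Y) → N} (hG : Continuous G) (ρ : PartitionOfUnity ι N) {V : ι → Set N}
    (hV : ∀ j, IsOpen (V j)) (hρ : ρ.IsSubordinate V) {Λ : ι → X → C(I, Y) → I → I → X}
    (hΛ : ∀ j, IsTransport f X' {q | q.1 ∈ G ⁻¹' V j ∧ q.2.1 ≤ q.2.2} (Λ j)) :
    ∃ R : X → C(I, Y) → I → X,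
      ContinuousOn (fun q : X × C(I, Y) × I => R q.1 q.2.1 q.2.2) {q | f q.1 = q.2.1 0} ∧
      ∀ x β, f x = β 0 → R x β 0 = x ∧ (∀ t, f (R x β t) = β t) ∧
        (x ∈ X' → ∀ t, R x β t ∈ X') := by
  let r : ι → C(I, Y) → ℝ := fun j β => ρ j (G β)
  have hr : ∀ j β, 0 ≤ r j β := fun j β => ρ.nonneg j _
  have hrc : ∀ j, Continuous (r j) := fun j => (ρ j).continuous.comp hG
  let J : C(I, Y) → List ι := fun β => (ρ.finsupport (G β)).sort
  have hJ : ∀ β, ∀ j ∈ J β, β ∈ G ⁻¹' V j := by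
    intro β j hj
    rw [Finset.mem_sort, ρ.mem_finsupport] at hj
    exact hρ j (subset_closure hj)
  have h0 : ∀ t : I, min t (projIcc 0 1 zero_le_one 0) = 0 := fun t => by
    rw [projIcc_left]
    exact min_eq_right t.2.1
  refine ⟨fun x β t => foldTransport r Λ (J β) x 0 β t, ?_, ?_⟩
  · rintro ⟨x₀, β₀, t₀⟩ (hx₀ : f x₀ = β₀ 0)
    -- Near `β₀` all active indices lie in this finite set, and every local transport indexed by it
    -- is defined; the extra indices have weight zero.
    let K := ρ.fintsupport (G β₀)
    let P : Set C(I, Y) := {β | ρ.finsupport (G β) ⊆ K ∧ ∀ j ∈ K, G β ∈ V j}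
    have hP : P ∈ 𝓝 β₀ := by
      refine inter_mem (hG.continuousAt.eventually (ρ.eventually_finsupport_subset _)) ?_
      refine (Finset.eventually_all K).2 fun j hj => hG.continuousAt.eventually ?_
      exact (hV j).mem_nhds (hρ j ((ρ.mem_fintsupport_iff _ _).1 hj))
    have hK : ∀ j ∈ K.sort, P ⊆ G ⁻¹' V j := fun j hj β hβ => hβ.2 j ((Finset.mem_sort _).1 hj)
    have heq : ∀ x, ∀ β ∈ P, ∀ t, f x = β 0 →
        foldTransport r Λ (J β) x 0 β t = foldTransport r Λ K.sort x 0 β t := by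
      intro x β hβ t hx
      classical
      have hJK : J β = K.sort.filter fun j => decide (j ∈ ρ.finsupport (G β)) := by
        refine List.Perm.eq_of_pairwise' (Finset.pairwise_sort _ _)
          ((Finset.pairwise_sort _ _).filter _) ?_
        refine (List.perm_ext_iff_of_nodup (Finset.sort_nodup _ _)
          ((Finset.sort_nodup _ _).filter _)).2 fun j => ?_
        simp only [List.mem_filter, Finset.mem_sort, decide_eq_true_eq]
        exact ⟨fun h => ⟨hβ.1 h, h⟩, fun h => h.2⟩
      rw [hJK]
      refine foldTransport_filter hr hΛ _ _ (fun j hj => hK j hj hβ) (fun j _ hj => ?_)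
        (by rw [h0, hx])
      simpa [ρ.mem_finsupport] using hj
    have hPw : {q : X × C(I, Y) × I | q.2.1 ∈ P} ∈ 𝓝 (x₀, β₀, t₀) :=
      (continuous_fst.comp continuous_snd).continuousAt.preimage_mem_nhds hP
    have hcont : ContinuousOn (fun q : X × C(I, Y) × I =>
        foldTransport r Λ K.sort q.1 0 q.2.1 q.2.2) {q | q.2.1 ∈ P ∧ f q.1 = q.2.1 0} := by
      refine (continuousOn_foldTransport hr hrc hΛ K.sort hK).comp
        (f := fun q : X × C(I, Y) × I => (q.1, (0 : ℝ), q.2.1, q.2.2)) (Continuous.continuousOn (by fun_prop)) ?_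
      exact fun q hq => ⟨hq.1, by simp only [h0, hq.2]⟩
    refine ((hcont (x₀, β₀, t₀) ⟨mem_of_mem_nhds hP, hx₀⟩).mono_of_mem_nhdsWithin
      (inter_mem (mem_nhdsWithin_of_mem_nhds hPw) self_mem_nhdsWithin)).congr_of_eventuallyEq
      ?_ (heq _ _ (mem_of_mem_nhds hP) _ hx₀)
    filter_upwards [mem_nhdsWithin_of_mem_nhds hPw, self_mem_nhdsWithin] with q hq hq'
      using heq _ _ hq _ hq'
  · intro x β hx
    have key := fun t => foldTransport_spec (r := r) hr hΛ (J β) (x := x) (c := 0) (t := t) (hJ β)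
      (by rw [h0, hx])
    refine ⟨(key 0).2.2 rfl, fun t => (key t).1.trans ?_, fun hxX t => (key t).2.1 hxX⟩
    -- The weights add up to one, so the consecutive time intervals fill `[0, 1]` and the transport
    -- reaches time `t`.
    have hs : ((J β).map (r · β)).sum = 1 := by
      rw [← List.sum_toFinset _ (Finset.sort_nodup _ _), Finset.sort_toFinset]
      exact ρ.sum_finsupport (mem_univ _)
    rw [hs, zero_add, projIcc_right]
    exact congrArg β (min_eq_left t.2.2)

/-- A partition of unity is pulled back from a metric space. -/
theorem PartitionOfUnity.exists_metricSpace {ι : Type u} (ρ : PartitionOfUnity ι Y) :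
    ∃ (M : Type u) (_ : MetricSpace M) (g : C(Y, M)) (O : ι → Set M), (∀ i, IsOpen (O i)) ∧
      (⋃ i, O i) = univ ∧ ∀ i, g ⁻¹' O i ⊆ Function.support (ρ i) := by
  let _ : TopologicalSpace ι := ⊥
  have : DiscreteTopology ι := ⟨rfl⟩
  let F : Y → BoundedContinuousFunction ι ℝ := fun y =>
    BoundedContinuousFunction.ofNormedAddCommGroupDiscrete (fun i => ρ i y) 1 fun i => by
      rw [Real.norm_eq_abs, abs_of_nonneg (ρ.nonneg i y)]
      exact ρ.le_one i y
  have hF : Continuous F := by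
    refine continuous_iff_continuousAt.2 fun y₀ => Metric.tendsto_nhds.2 fun ε hε => ?_
    -- By local finiteness the sup distance near `y₀` involves only finitely many coordinates.
    obtain ⟨K, -, hK⟩ := ρ.exists_finset_nhds' y₀
    have h : ∀ᶠ y in 𝓝 y₀, ∀ i ∈ K, dist (ρ i y) (ρ i y₀) < ε / 2 :=
      (Finset.eventually_all K).2 fun i _ =>
        Metric.tendsto_nhds.1 (ρ i).continuous.continuousAt _ (half_pos hε)
    filter_upwards [hK, h] with y h1 h2
    refine lt_of_le_of_lt ((BoundedContinuousFunction.dist_le (half_pos hε).le).2 fun i => ?_)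
      (half_lt_self hε)
    by_cases hi : i ∈ K
    · exact (h2 i hi).le
    · have e1 : ρ i y = 0 := by
        by_contra h
        exact hi (h1 h)
      have e2 : ρ i y₀ = 0 := by
        by_contra h
        exact hi (hK.self_of_nhds h)
      simpa [F, e1, e2] using (half_pos hε).le
  -- Keeping only functions with a positive coordinate makes the sets where coordinate `i` is
  -- positive a cover.
  refine ⟨{m : BoundedContinuousFunction ι ℝ // ∃ i, 0 < m i}, inferInstance,
    ⟨fun y => ⟨F y, ρ.exists_pos (mem_univ y)⟩, hF.subtype_mk _⟩, fun i => {m | 0 < m.1 i}, ?_, ?_,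
    ?_⟩
  · exact fun i => isOpen_lt continuous_const
      ((BoundedContinuousFunction.lipschitz_eval_const i).continuous.comp continuous_subtype_val)
  · exact eq_univ_of_forall fun m => mem_iUnion.2 m.2
  · exact fun i y hy => (ne_of_gt hy : _)

/-- The partition of unity lives on the metrizable space `C(I, M)` and is pulled back to `C(I, Y)`
by composition with `g`, so paracompactness of `C(I, Y)` is not needed. -/
theorem IsStratifiedBundle.exists_transport {Z : Type*} [TopologicalSpace Z] {A : Set Z}
    [T2Space Y] [ParacompactSpace Y] (hf : IsStratifiedBundle f X' A) :
    ∃ R : X → C(I, Y) → I → X,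
      ContinuousOn (fun q : X × C(I, Y) × I => R q.1 q.2.1 q.2.2) {q | f q.1 = q.2.1 0} ∧
      ∀ x β, f x = β 0 → R x β 0 = x ∧ (∀ t, f (R x β t) = β t) ∧
        (x ∈ X' → ∀ t, R x β t ∈ X') := by
  choose U hU hyU e he heA using hf.locally_trivial
  obtain ⟨ρ, hρ⟩ := PartitionOfUnity.exists_isSubordinate isClosed_univ U hU
    fun y _ => mem_iUnion.2 ⟨y, hyU y⟩
  obtain ⟨M, _, g, O, hO, hOM, hgO⟩ := ρ.exists_metricSpace
  have hOU : ∀ i y, g y ∈ O i → y ∈ U i := fun i y hy => hρ i (subset_closure (hgO i hy))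
  have key : ∀ m : C(I, M), ∃ V : Set C(I, M), IsOpen V ∧ m ∈ V ∧ ∃ Λ,
      IsTransport f X' {q | q.1 ∈ g.comp ⁻¹' V ∧ q.2.1 ≤ q.2.2} Λ := by
    intro m
    obtain ⟨t, ht0, ht, ⟨n, hn⟩, hti⟩ := exists_monotone_Icc_subset_open_cover_unitInterval
      (c := fun i => m ⁻¹' O i) (fun i => (hO i).preimage m.continuous)
      (by rw [← preimage_iUnion, hOM, preimage_univ])
    have ind : ∀ n, ∃ V : Set C(I, M), IsOpen V ∧ m ∈ V ∧ ∃ Λ,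
        IsTransport f X' {q | q.1 ∈ g.comp ⁻¹' V ∧ q.2.1 ≤ q.2.2 ∧ q.2.2 ≤ t n} Λ := by
      intro n
      induction n with
      | zero =>
        -- Since `t 0 = 0`, only `a = b = 0` occurs.
        refine ⟨univ, isOpen_univ, mem_univ _, fun x _ _ _ => x, continuousOn_fst, ?_,
          fun _ _ => rfl, fun _ _ hx => hx⟩
        rintro x β a b ⟨-, hab : a ≤ b, hb : b ≤ t 0⟩ hx
        rw [ht0] at hb
        obtain rfl : b = 0 := le_antisymm hb b.2.1
        obtain rfl : a = 0 := le_antisymm hab a.2.1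
        exact hx
      | succ n ih =>
        obtain ⟨V, hVo, hmV, Λ₁, h₁⟩ := ih
        obtain ⟨i, hi⟩ := hti n
        obtain ⟨Λ₂, h₂⟩ := exists_isTransport_of_trivialization (e i) (he i) (heA i)
        refine ⟨V ∩ {m' | MapsTo m' (Icc (t n) (t (n + 1))) (O i)},
          hVo.inter (ContinuousMap.isOpen_setOfPred_mapsTo isCompact_Icc (hO i)), ⟨hmV, hi⟩, ?_⟩
        refine h₁.exists_trans (V' := g.comp ⁻¹' {m' | MapsTo m' (Icc (t n) (t (n + 1))) (O i)})
          (h₂.mono ?_)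
        rintro ⟨β, a, b⟩ ⟨hβ, hna, hab, hbn⟩
        exact ⟨hOU i _ (hβ ⟨hna, hab.trans hbn⟩), hOU i _ (hβ ⟨hna.trans hab, hbn⟩)⟩
    obtain ⟨V, hVo, hmV, Λ, hΛ⟩ := ind n
    refine ⟨V, hVo, hmV, Λ, hΛ.mono fun q hq => ⟨hq.1, hq.2, ?_⟩⟩
    rw [hn n le_rfl]
    exact q.2.2.2.2
  choose V hV hmV Λ hΛ using key
  obtain ⟨τ, hτ⟩ := PartitionOfUnity.exists_isSubordinate isClosed_univ V hV
    fun m _ => mem_iUnion.2 ⟨m, hmV m⟩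
  -- Any linear order will do: it only fixes the order in which the local transports are applied.
  let _ : LinearOrder C(I, M) := IsWellOrder.linearOrder WellOrderingRel
  exact exists_transport_of_partitionOfUnity (G := g.comp) g.continuous_postcomp τ hV hτ hΛ

/-! ### Concatenation of paths -/

/-- Families of paths `Φ` and `Ψ` can be concatenated, where only the part of `Ψ` up to time `ℓ` is
used, in such a way that nothing is changed if `ℓ = 0`. -/
theorem exists_concat {T : Type*} {X : Type*} [TopologicalSpace T] [TopologicalSpace X]
    {Φ Ψ : T → I → X} {ℓ : T → I} (hΦ : Continuous fun q : T × I => Φ q.1 q.2)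
    (hΨ : Continuous fun q : T × I => Ψ q.1 q.2) (hℓ : Continuous ℓ) (h : ∀ τ, Φ τ 1 = Ψ τ 0) :
    ∃ c : C(T, C(I, X)), ∀ τ, c τ 0 = Φ τ 0 ∧ c τ 1 = Ψ τ (ℓ τ) ∧
      (ℓ τ = 0 → ∀ s, c τ s = Φ τ s) ∧
      ∀ s, (∃ u, c τ s = Φ τ u) ∨ ∃ u ≤ ℓ τ, c τ s = Ψ τ u := by
  let pr : ℝ → I := projIcc 0 1 zero_le_one
  have hpr : Continuous pr := continuous_projIcc
  have hval : ∀ s : I, pr s = s := fun s => projIcc_val _ s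
  have hΦ' : Continuous fun q : T × I => Φ q.1 (pr (q.2 * (1 + ℓ q.1))) :=
    hΦ.comp (f := fun q : T × I => (q.1, pr (q.2 * (1 + ℓ q.1)))) (by fun_prop)
  have hΨ' : Continuous fun q : T × I => Ψ q.1 (pr (q.2 * (1 + ℓ q.1) - 1)) :=
    hΨ.comp (f := fun q : T × I => (q.1, pr (q.2 * (1 + ℓ q.1) - 1))) (by fun_prop)
  -- The concatenation runs at speed `1 + ℓ`, so `ℓ = 0` causes no reparametrization. The usual
  -- concatenation at double speed would not restrict to the given initial point of a lift.
  let F : C(T × I, X) := ⟨fun q => if (q.2 * (1 + ℓ q.1) : ℝ) ≤ 1 then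
      Φ q.1 (pr (q.2 * (1 + ℓ q.1))) else Ψ q.1 (pr (q.2 * (1 + ℓ q.1) - 1)), by
    refine Continuous.if_le hΦ' hΨ' (by fun_prop) continuous_const fun q hq => ?_
    rw [hq, sub_self, show pr 1 = 1 from projIcc_right _, show pr 0 = 0 from projIcc_left _, h]⟩
  have hF : ∀ τ s, F.curry τ s = if (s * (1 + ℓ τ) : ℝ) ≤ 1 then
      Φ τ (pr (s * (1 + ℓ τ))) else Ψ τ (pr (s * (1 + ℓ τ) - 1)) := fun τ s => rfl
  refine ⟨F.curry, fun τ => ⟨?_, ?_, fun h0 s => ?_, fun s => ?_⟩⟩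
  · rw [hF, if_pos (by simp)]
    simp [pr, projIcc_left]
  · rw [hF]
    simp only [Icc.coe_one, one_mul, add_sub_cancel_left, hval]
    split_ifs with h1
    · have h0 : ℓ τ = 0 := le_antisymm (by
        rw [← Subtype.coe_le_coe]; simpa using h1) (ℓ τ).2.1
      rw [h0, Icc.coe_zero, add_zero, show pr 1 = 1 from projIcc_right _, h]
    · rfl
  · rw [hF, h0, Icc.coe_zero, add_zero, mul_one, if_pos s.2.2, hval]
  · rw [hF]
    split_ifs with h1
    · exact .inl ⟨_, rfl⟩
    · refine .inr ⟨_, ?_, rfl⟩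
      refine le_of_le_of_eq ?_ (hval (ℓ τ))
      refine monotone_projIcc _ ?_
      have := mul_le_mul_of_nonneg_right s.2.2 (show (0 : ℝ) ≤ 1 + ℓ τ by linarith [(ℓ τ).2.1])
      linarith

/-- The path `s ↦ β (u + s)`, constant as soon as `u + s ≥ 1`. -/
noncomputable def shiftPath {Y : Type*} [TopologicalSpace Y] : C(C(I, Y) × I, C(I, Y)) :=
  ContinuousMap.curry ⟨fun q => q.1.1 (projIcc 0 1 zero_le_one (q.1.2 + q.2 : ℝ)), by
    have : Continuous (projIcc (0 : ℝ) 1 zero_le_one) := continuous_projIcc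
    fun_prop⟩

theorem shiftPath_apply {Y : Type*} [TopologicalSpace Y] (β : C(I, Y)) (u s : I) :
    shiftPath (β, u) s = β (projIcc 0 1 zero_le_one (u + s : ℝ)) := rfl

/-! ### The map `ξ_k` is a fibration -/

section Fibration

variable {X : Type u} {Y : Type v} [TopologicalSpace X] [TopologicalSpace Y] {f : X → Y}
  {X' : Set X}

/-- Paths in a fiber of `f` which start in `X'`. -/
abbrev VerticalPath (f : X → Y) (X' : Set X) : Type u :=
  {φ : C(I, X) // (∀ s, f (φ s) = f (φ 0)) ∧ φ 0 ∈ X'}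

/-- A vertical path, a path in `X` issued from its endpoint, and a time. -/
abbrev VerticalLiftingData (f : X → Y) (X' : Set X) : Type u :=
  {q : VerticalPath f X' × C(I, X) × I // q.1.1 1 = q.2.1 0}

open Classical in
theorem hasPathLifting_verticalPaths {Z : Type*} [TopologicalSpace Z] {A : Set Z} [T2Space Y]
    [ParacompactSpace Y] (hf : IsStratifiedBundle f X' A) :
    HasPathLifting (verticalPaths f X').proj := by
  obtain ⟨R, hRc, hR⟩ := hf.exists_transport
  let fC : C(X, Y) := ⟨f, hf.continuous⟩
  let pr : ℝ → I := projIcc 0 1 zero_le_one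
  have hpr : Continuous pr := continuous_projIcc
  have hval : ∀ s : I, pr s = s := fun s => projIcc_val _ s
  -- `Φ` moves the vertical path into the fiber over `f (γ t)`; `Ψ` joins its new endpoint to `γ t`
  -- inside that fiber.
  let Φ : VerticalLiftingData f X' → I → X := fun τ s => R (τ.1.1.1 s) (fC.comp τ.1.2.1) τ.1.2.2
  let Ψ : VerticalLiftingData f X' → I → X := fun τ s =>
    R (τ.1.2.1 s) (shiftPath (fC.comp τ.1.2.1, s)) (pr (τ.1.2.2 - s))
  have hfΦ : ∀ (τ : VerticalLiftingData f X') s, f (τ.1.1.1 s) = fC.comp τ.1.2.1 0 := fun τ s =>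
    ((τ.1.1.2.1 s).trans (τ.1.1.2.1 1).symm).trans (congrArg f τ.2)
  have hfΨ : ∀ (τ : VerticalLiftingData f X') s, f (τ.1.2.1 s) = shiftPath (fC.comp τ.1.2.1, s) 0 := fun τ s => by
    rw [shiftPath_apply, Icc.coe_zero, add_zero, projIcc_val]
    rfl
  have hcomp : Continuous fun q : VerticalLiftingData f X' × I => fC.comp q.1.1.2.1 :=
    fC.continuous_postcomp.comp (by fun_prop)
  obtain ⟨c, hc⟩ := exists_concat (Φ := Φ) (Ψ := Ψ) (ℓ := fun τ => τ.1.2.2)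
    (by
      refine hRc.comp_continuous (f := fun q : VerticalLiftingData f X' × I =>
        (q.1.1.1.1 q.2, fC.comp q.1.1.2.1, q.1.1.2.2)) ?_ fun q => hfΦ q.1 q.2
      refine Continuous.prodMk ?_ (hcomp.prodMk (by fun_prop))
      exact (ContinuousEval.continuous_eval (F := C(I, X))).comp
        (f := fun q : VerticalLiftingData f X' × I => (q.1.1.1.1, q.2)) (by fun_prop))
    (by
      refine hRc.comp_continuous (f := fun q : VerticalLiftingData f X' × I =>
        (q.1.1.2.1 q.2, shiftPath (fC.comp q.1.1.2.1, q.2), pr (q.1.1.2.2 - q.2))) ?_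
        fun q => hfΨ q.1 q.2
      refine Continuous.prodMk (by fun_prop) (Continuous.prodMk ?_ (by fun_prop))
      exact shiftPath.continuous.comp (hcomp.prodMk continuous_snd))
    (by fun_prop)
    (by
      intro τ
      have h1 : shiftPath (fC.comp τ.1.2.1, 0) = fC.comp τ.1.2.1 := by
        ext s
        rw [shiftPath_apply, Icc.coe_zero, zero_add, projIcc_val]
      simp only [Φ, Ψ, h1, Icc.coe_zero, sub_zero, hval, τ.2])
  have hf_c : ∀ τ s, f (c τ s) = f (τ.1.2.1 τ.1.2.2) := by
    intro τ s
    rcases (hc τ).2.2.2 s with ⟨u, hu⟩ | ⟨u, hut, hu⟩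
    · rw [hu]
      exact (hR _ _ (hfΦ τ u)).2.1 _
    · rw [hu, (hR _ _ (hfΨ τ u)).2.1, shiftPath_apply]
      -- Because `u ≤ t`, the clamp `pr` is inactive, and the transport from time `u` lasts exactly
      -- `t - u`.
      have hle : (0 : ℝ) ≤ τ.1.2.2 - u := sub_nonneg.2 hut
      have : ((pr (τ.1.2.2 - u) : I) : ℝ) = τ.1.2.2 - u := by
        simp only [pr, coe_projIcc]
        rw [min_eq_right (by linarith [τ.1.2.2.2.2, u.2.1]), max_eq_right hle]
      rw [this, add_sub_cancel, projIcc_val]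
      rfl
  have hX : ∀ τ, c τ 0 ∈ X' := by
    intro τ
    rw [(hc τ).1]
    exact (hR _ _ (hfΦ τ 0)).2.2 τ.1.1.2.2 _
  let C : VerticalLiftingData f X' → VerticalPath f X' := fun τ => ⟨c τ, fun s => (hf_c τ s).trans (hf_c τ 0).symm, hX τ⟩
  have hC : Continuous C := c.continuous.subtype_mk _
  let L : VerticalPath f X' → C(I, X) → I → VerticalPath f X' := fun φ γ t => if h : φ.1 1 = γ 0 then C ⟨(φ, γ, t), h⟩ else φ
  have hL : ∀ φ γ t (h : φ.1 1 = γ 0), L φ γ t = C ⟨(φ, γ, t), h⟩ := fun φ γ t h => dif_pos h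
  have hcont : Continuous fun φ : VerticalPath f X' => φ.1 1 := by
    fun_prop
  refine ⟨hcont, L, ?_, ?_⟩
  · refine continuousOn_iff_continuous_domRestrict.2 (hC.congr fun τ => ?_)
    exact (hL _ _ _ τ.2).symm
  · intro φ γ h
    refine ⟨(hL φ γ 0 h).trans (Subtype.ext (ContinuousMap.ext fun s => ?_)), fun t => ?_⟩
    · refine ((hc ⟨(φ, γ, 0), h⟩).2.2.1 rfl s).trans ?_
      exact (hR _ _ (hfΦ ⟨(φ, γ, 0), h⟩ s)).1
    · refine (congrArg (fun φ : VerticalPath f X' => φ.1 1) (hL φ γ t h)).trans ?_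
      refine (hc ⟨(φ, γ, t), h⟩).2.1.trans ?_
      simp only [Ψ, sub_self]
      rw [show pr 0 = 0 from projIcc_left _]
      exact (hR _ _ (hfΨ ⟨(φ, γ, t), h⟩ t)).1

theorem hasPathLifting_ganeaBundle {Z : Type*} [TopologicalSpace Z] {A : Set Z} [T2Space Y]
    [ParacompactSpace Y] (hf : IsStratifiedBundle f X' A) (k : ℕ) :
    HasPathLifting (ganeaBundle f X' k).proj := by
  induction k with
  | zero => exact hasPathLifting_verticalPaths hf
  | succ k ih => exact SpaceOver.hasPathLifting_fiberJoin (hasPathLifting_verticalPaths hf) ih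

end Fibration

/-! ### The fibers of `ξ_k` -/

section Fibers

variable {X : Type u} {Y : Type v} [TopologicalSpace X] {f : X → Y} {X' : Set X}

/-- All `ξ_k` have the same image, so the fibers being joined are empty simultaneously. -/
theorem exists_verticalPaths_iff_exists_ganeaBundle (k : ℕ) (x : X) :
    (∃ a, (verticalPaths f X').proj a = x) ↔ ∃ b, (ganeaBundle f X' k).proj b = x := by
  induction k with
  | zero => rfl
  | succ k ih =>
    constructor
    · intro h
      obtain ⟨⟨a, ha⟩, b, hb⟩ := And.intro h (ih.1 h)
      exact ⟨⟨TopJoin.seg a b 0, a, b, ha.trans hb.symm, 0, rfl⟩,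
        (TopJoin.elim_seg _ _ (ha.trans hb.symm) 0).trans ha⟩
    · rintro ⟨b, hb⟩
      exact ((SpaceOver.exists_fiberJoin_proj_iff _ _).1 ⟨b.2, hb⟩).1

/-- A vertical path ending at `x` stays in `f ⁻¹' {y}`, and composition with the embedding `e.symm`
of `Z` into `X` induces the topology of the path space. -/
theorem nonempty_verticalPaths_fiber_homeomorph {Z : Type*} [TopologicalSpace Z] {A : Set Z} {y : Y}
    (e : (f ⁻¹' {y}) ≃ₜ Z) (he : ∀ x, e x ∈ A ↔ (x : X) ∈ X') (x : f ⁻¹' {y}) :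
    Nonempty ((verticalPaths f X').proj ⁻¹' {(x : X)} ≃ₜ pathsFromEnd A ⁻¹' {e x}) := by
  let i : C(Z, X) := ⟨fun z => e.symm z, continuous_subtype_val.comp e.symm.continuous⟩
  have hi : IsInducing i := IsInducing.subtypeVal.comp e.symm.isInducing
  have hfi : ∀ z, f (i z) = y := fun z => (e.symm z).2
  have hiX : ∀ z, i z ∈ X' ↔ z ∈ A := fun z => by
    rw [← e.apply_symm_apply z, he]
    simp [i]
  have hix : i (e x) = x := by simp [i]
  have hinj : Function.Injective i := Subtype.val_injective.comp e.symm.injective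
  let F : pathsFromEnd A ⁻¹' {e x} → {φ : VerticalPath f X' // φ.1 1 = x} := fun φ =>
    ⟨⟨i.comp φ.1.1, fun s => (hfi _).trans (hfi _).symm, (hiX _).2 φ.1.2⟩,
      (congrArg i φ.2).trans hix⟩
  have hF : IsInducing F := by
    have h : IsInducing fun φ : {φ : VerticalPath f X' // φ.1 1 = x} => φ.1.1 :=
      IsInducing.subtypeVal.comp IsInducing.subtypeVal
    refine h.of_comp_iff.1 ?_
    exact (i.isInducing_postcomp hi).comp (IsInducing.subtypeVal.comp IsInducing.subtypeVal)
  have hFi : Function.Injective F := by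
    intro φ ψ h
    refine Subtype.ext (Subtype.ext (ContinuousMap.ext fun s => hinj ?_))
    exact congrArg (fun φ : {φ : VerticalPath f X' // φ.1 1 = x} => φ.1.1 s) h
  have hFs : Function.Surjective F := by
    intro φ
    have hy : ∀ s, f (φ.1.1 s) = y := fun s => by
      rw [φ.1.2.1 s, ← φ.1.2.1 1, φ.2]
      exact x.2
    let ψ : C(I, Z) := ⟨fun s => e ⟨φ.1.1 s, hy s⟩, by
      exact e.continuous.comp (φ.1.1.continuous.subtype_mk _)⟩
    have hψ : ∀ s, i (ψ s) = φ.1.1 s := fun s => by simp [i, ψ]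
    refine ⟨⟨⟨ψ, ?_⟩, ?_⟩, ?_⟩
    · rw [← hiX, hψ]
      exact φ.1.2.2
    · exact hinj ((hψ 1).trans (φ.2.trans hix.symm))
    · exact Subtype.ext (Subtype.ext (ContinuousMap.ext hψ))
  exact ⟨((Equiv.ofBijective F ⟨hFi, hFs⟩).toHomeomorphOfIsInducing hF).symm⟩

theorem nonempty_ganeaBundle_fiber_homeomorph {Z : Type*} [TopologicalSpace Z] {A : Set Z} {y : Y}
    (e : (f ⁻¹' {y}) ≃ₜ Z) (he : ∀ x, e x ∈ A ↔ (x : X) ∈ X') (x : f ⁻¹' {y}) (k : ℕ) :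
    Nonempty ((ganeaBundle f X' k).proj ⁻¹' {(x : X)} ≃ₜ
      joinPower (TopCat.of (pathsFromEnd A ⁻¹' {e x})) k) := by
  induction k with
  | zero => exact nonempty_verticalPaths_fiber_homeomorph e he x
  | succ k ih =>
    obtain ⟨h⟩ := ih
    obtain ⟨h₀⟩ := nonempty_verticalPaths_fiber_homeomorph e he x
    obtain ⟨h₁⟩ := SpaceOver.nonempty_fiberJoin_fiber_homeomorph (x : X)
      (exists_verticalPaths_iff_exists_ganeaBundle (f := f) (X' := X') k x)
    exact ⟨h₁.symm.trans (h₀.topJoin h)⟩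

theorem nonempty_homotopyEquiv_joinPower {F F' : TopCat.{u}}
    (h : Nonempty (ContinuousMap.HomotopyEquiv F F')) (k : ℕ) :
    Nonempty (ContinuousMap.HomotopyEquiv (joinPower F k) (joinPower F' k)) := by
  induction k with
  | zero => exact h
  | succ k ih =>
    obtain ⟨e⟩ := h
    obtain ⟨e'⟩ := ih
    exact ⟨e.topJoin e'⟩

/-- Paths ending at `γ a`, together with the time `a` and a further time. -/
abbrev EndpointOn {Z : Type*} [TopologicalSpace Z] {z z' : Z} (γ : Path z z') : Type _ :=
  {q : C(I, Z) × I × I // q.1 1 = γ q.2.1}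

theorem nonempty_homotopyEquiv_pathsFromEnd_fiber {Z : Type*} [TopologicalSpace Z] (A : Set Z)
    {z z' : Z} (h : Joined z z') : Nonempty (ContinuousMap.HomotopyEquiv
      (pathsFromEnd A ⁻¹' {z}) (pathsFromEnd A ⁻¹' {z'})) := by
  obtain ⟨γ⟩ := h
  let pr : ℝ → I := projIcc 0 1 zero_le_one
  have hpr : Continuous pr := continuous_projIcc
  have hval : ∀ s : I, pr s = s := fun s => projIcc_val _ s
  obtain ⟨c, hc⟩ := exists_concat (T := EndpointOn γ) (Φ := fun τ s => τ.1.1 s)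
    -- The parameter of `γ` moves at unit speed from `a` to `b`, in either direction, arriving at
    -- time `|b - a|`; for `a = b` nothing is appended.
    (Ψ := fun τ s => γ (pr (τ.1.2.1 + max (-s : ℝ) (min s (τ.1.2.2 - τ.1.2.1)))))
    (ℓ := fun τ => pr |(τ.1.2.2 - τ.1.2.1 : ℝ)|) (by fun_prop) (by fun_prop) (by fun_prop) (by
      intro τ
      have : max (-((0 : I) : ℝ)) (min ((0 : I) : ℝ) (τ.1.2.2 - τ.1.2.1)) = 0 := by simp
      rw [this, add_zero, hval, τ.2])
  have hc1 : ∀ τ, c τ 1 = γ τ.1.2.2 := by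
    intro τ
    rw [(hc τ).2.1]
    have h1 : |(τ.1.2.2 - τ.1.2.1 : ℝ)| ≤ 1 := by
      rw [abs_le]
      constructor <;> linarith [τ.1.2.2.2.1, τ.1.2.2.2.2, τ.1.2.1.2.1, τ.1.2.1.2.2]
    have h2 : ((pr |(τ.1.2.2 - τ.1.2.1 : ℝ)| : I) : ℝ) = |(τ.1.2.2 - τ.1.2.1 : ℝ)| := by
      simp only [pr, coe_projIcc]
      rw [min_eq_right h1, max_eq_right (abs_nonneg _)]
    rw [h2, min_eq_right (le_abs_self _), max_eq_right (neg_abs_le _), add_sub_cancel, hval]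
  have hc_refl : ∀ τ : EndpointOn γ, τ.1.2.1 = τ.1.2.2 → c τ = τ.1.1 := by
    intro τ h
    refine ContinuousMap.ext ((hc τ).2.2.1 ?_)
    rw [h, sub_self, abs_zero]
    exact projIcc_left _
  let G : I → Set (PathsFrom A) := fun a => pathsFromEnd A ⁻¹' {γ a}
  let tr : (a b : I) → C(G a, G b) := fun a b =>
    ⟨fun φ => ⟨⟨c ⟨(φ.1.1, a, b), φ.2⟩, by rw [(hc _).1]; exact φ.1.2⟩, hc1 _⟩, by
      refine Continuous.subtype_mk (Continuous.subtype_mk (c.continuous.comp ?_) _) _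
      exact Continuous.subtype_mk (by fun_prop) _⟩
  have key : ∀ a b, ((tr b a).comp (tr a b)).Homotopic (ContinuousMap.id _) := by
    intro a b
    -- The homotopy slides the turning point of the detour `a → b → a` back to `a`, where both
    -- appended pieces have length zero.
    let m : I → I := fun r => pr (b + r * (a - b))
    have hm : Continuous m := by fun_prop
    have hm0 : m 0 = b := by simp [m, hval]
    have hm1 : m 1 = a := by simp [m, hval]
    let c₁ : I × G a → C(I, Z) := fun q => c ⟨(q.2.1.1, a, m q.1), q.2.2⟩
    have hc₁ : Continuous c₁ := c.continuous.comp (Continuous.subtype_mk (by fun_prop) _)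
    let c₂ : I × G a → C(I, Z) := fun q => c ⟨(c₁ q, m q.1, a), hc1 _⟩
    have hc₂ : Continuous c₂ := c.continuous.comp (Continuous.subtype_mk (by fun_prop) _)
    have hc₂A : ∀ q, c₂ q 0 ∈ A := fun q => by
      rw [(hc _).1]
      change c₁ q 0 ∈ A
      rw [(hc _).1]
      exact q.2.1.2
    let K : C(I × G a, G a) :=
      ⟨fun q => ⟨⟨c₂ q, hc₂A q⟩, hc1 _⟩, (hc₂.subtype_mk hc₂A).subtype_mk _⟩
    refine ⟨⟨K, fun φ => Subtype.ext (Subtype.ext ?_), fun φ => Subtype.ext (Subtype.ext ?_)⟩⟩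
    · refine congrArg c (Subtype.ext (Prod.ext (congrArg c (Subtype.ext ?_)) (Prod.ext hm0 rfl)))
      exact congrArg (fun t => (φ.1.1, a, t)) hm0
    · exact (hc_refl _ hm1).trans (hc_refl _ hm1.symm)
  have e : ContinuousMap.HomotopyEquiv (G 0) (G 1) :=
    ⟨tr 0 1, tr 1 0, key 0 1, key 1 0⟩
  have h0 : G 0 = pathsFromEnd A ⁻¹' {z} := by simp [G]
  have h1 : G 1 = pathsFromEnd A ⁻¹' {z'} := by simp [G]
  rw [← h0, ← h1]
  exact ⟨e⟩

end Fibers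

/-! ### Sections of `ξ_k` -/

section Sections

theorem TopJoin.continuous_left_get {A B : Type*} [TopologicalSpace A] [TopologicalSpace B] :
    Continuous fun z : {z : TopJoin A B // z.t ≠ 1} => z.1.left.get (z.1.left_isSome.2 z.2) := by
  refine continuous_iff_continuousAt.2 fun z => ?_
  obtain ⟨a, ha⟩ := TopJoin.exists_left z.2
  have h : z.1.left.get (z.1.left_isSome.2 z.2) = a := by simp [ha]
  have := (TopJoin.tendsto_left_getD ha).comp (continuous_subtype_val.tendsto z)
  rw [ContinuousAt, h]
  refine this.congr' ?_
  filter_upwards [(continuous_subtype_val.tendsto z).eventually (TopJoin.eventually_left ha)]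
    with z' hz'
  exact (Option.get_of_eq_some _ hz').symm

theorem TopJoin.continuous_right_get {A B : Type*} [TopologicalSpace A] [TopologicalSpace B] :
    Continuous fun z : {z : TopJoin A B // z.t ≠ 0} => z.1.right.get (z.1.right_isSome.2 z.2) := by
  refine continuous_iff_continuousAt.2 fun z => ?_
  obtain ⟨a, ha⟩ := TopJoin.exists_right z.2
  have h : z.1.right.get (z.1.right_isSome.2 z.2) = a := by simp [ha]
  have := (TopJoin.tendsto_right_getD ha).comp (continuous_subtype_val.tendsto z)
  rw [ContinuousAt, h]
  refine this.congr' ?_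
  filter_upwards [(continuous_subtype_val.tendsto z).eventually (TopJoin.eventually_right ha)]
    with z' hz'
  exact (Option.get_of_eq_some _ hz').symm

variable {X : Type u} {Y : Type v} [TopologicalSpace X] {f : X → Y} {X' : Set X}

/-- A section of `ξ_0` over `V` picks for each `x` a vertical path from `X'` to `x`; running it
backwards deforms `V`. -/
theorem fiberwiseDeformable_of_section {V : Set X} {g : V → (verticalPaths f X').total}
    (hg : Continuous g) (h : ∀ x, (verticalPaths f X').proj (g x) = x) :
    FiberwiseDeformable f V X' := by
  let τ : V → VerticalPath f X' := g
  have hτ : Continuous τ := hg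
  have h1 : ∀ x, (τ x).1 1 = x := h
  refine ⟨⟨fun q => (τ q.1).1 (symm q.2), by fun_prop⟩, fun x => ?_, fun x => ?_, fun x s => ?_⟩
  · simp [h1]
  · simpa using (τ x).2.2
  · refine ((τ x).2.1 _).trans (((τ x).2.1 1).symm.trans ?_)
    rw [h1]

/-- Sections over open subsets are allowed, since the inductive step only yields a section of the
previous map over the open set where `t ≠ 0`. -/
theorem exists_cover_of_section (k : ℕ) {V : Set X} (hV : IsOpen V)
    {g : V → (ganeaBundle f X' k).total} (hg : Continuous g)
    (h : ∀ x, (ganeaBundle f X' k).proj (g x) = x) :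
    ∃ U : Fin (k + 1) → Set X, (∀ i, IsOpen (U i)) ∧ (⋃ i, U i) = V ∧
      ∀ i, FiberwiseDeformable f (U i) X' := by
  induction k generalizing V with
  | zero =>
    exact ⟨fun _ => V, fun _ => hV, iUnion_const V, fun _ => fiberwiseDeformable_of_section hg h⟩
  | succ k ih =>
    let E := verticalPaths f X'
    let E' := ganeaBundle f X' k
    let j : V → TopJoin E.total E'.total := fun x => (g x).1
    have hj : Continuous j := continuous_subtype_val.comp hg
    have hjl : ∀ x a, (j x).left = some a → E.proj a = x := fun x a ha =>
      (SpaceOver.proj_left (E := E) (E' := E') (g x) ha).trans (h x)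
    have hjr : ∀ x a, (j x).right = some a → E'.proj a = x := fun x a ha =>
      (SpaceOver.proj_right (E := E) (E' := E') (g x) ha).trans (h x)
    have ht : Continuous fun x => (j x).t := TopJoin.continuous_t.comp hj
    let V₀ : Set X := {x | ∃ hx : x ∈ V, (j ⟨x, hx⟩).t ≠ 1}
    let V₁ : Set X := {x | ∃ hx : x ∈ V, (j ⟨x, hx⟩).t ≠ 0}
    have hV₀ : IsOpen V₀ := by
      convert hV.isOpenMap_subtype_val _ (isOpen_ne.preimage ht : IsOpen {x | (j x).t ≠ 1}) using 1
      ext x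
      simp [V₀]
    have hV₁ : IsOpen V₁ := by
      convert hV.isOpenMap_subtype_val _ (isOpen_ne.preimage ht : IsOpen {x | (j x).t ≠ 0}) using 1
      ext x
      simp [V₁]
    have hj₀ : Continuous fun x : V₀ =>
        (⟨j ⟨x, x.2.1⟩, x.2.2⟩ : {z : TopJoin E.total E'.total // z.t ≠ 1}) :=
      (hj.comp (continuous_subtype_val.subtype_mk _)).subtype_mk _
    have hj₁ : Continuous fun x : V₁ =>
        (⟨j ⟨x, x.2.1⟩, x.2.2⟩ : {z : TopJoin E.total E'.total // z.t ≠ 0}) :=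
      (hj.comp (continuous_subtype_val.subtype_mk _)).subtype_mk _
    obtain ⟨U, hU, hUV, hUd⟩ := ih hV₁ (TopJoin.continuous_right_get.comp hj₁)
      fun x => hjr ⟨x, x.2.1⟩ _ (Option.some_get _).symm
    refine ⟨Fin.cons V₀ U, Fin.forall_fin_succ.2 ⟨hV₀, hU⟩, ?_, Fin.forall_fin_succ.2 ⟨?_, hUd⟩⟩
    · have : (⋃ i, (Fin.cons V₀ U : Fin (k + 2) → Set X) i) = V₀ ∪ ⋃ i, U i := by
        ext x
        simp [Fin.exists_fin_succ]
      rw [this, hUV]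
      ext x
      constructor
      · rintro (hx | hx) <;> exact hx.1
      · intro hx
        by_cases h1 : (j ⟨x, hx⟩).t = 1
        · exact .inr ⟨hx, by rw [h1]; exact one_ne_zero⟩
        · exact .inl ⟨hx, h1⟩
    · exact fiberwiseDeformable_of_section (TopJoin.continuous_left_get.comp hj₀)
        fun x => hjl ⟨x, x.2.1⟩ _ (Option.some_get _).symm

end Sections

theorem mainTheorem4 {X : Type u} {Y : Type v} {Z : Type*} [TopologicalSpace X]
    [TopologicalSpace Y] [TopologicalSpace Z] [T2Space X] [ParacompactSpace X] [T2Space Y]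
    [ParacompactSpace Y] (f : X → Y) (X' : Set X) (A : Set Z) (hf : IsStratifiedBundle f X' A)
    (hA : ContractibleIn A) (k : ℕ) :
    IsHurewiczFibration.{_, _, w} (ganeaBundle f X' k).proj ∧
    (∀ (y : Y) (e : (f ⁻¹' {y}) ≃ₜ Z), (∀ x, e x ∈ A ↔ (x : X) ∈ X') → ∀ x : f ⁻¹' {y},
      Nonempty (((ganeaBundle f X' k).proj ⁻¹' {(x : X)}) ≃ₜ
        joinPower (TopCat.of (pathsFromEnd A ⁻¹' {e x})) k) ∧
      ∀ z : Z, Joined (e x) z →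
        Nonempty (ContinuousMap.HomotopyEquiv ((ganeaBundle f X' k).proj ⁻¹' {(x : X)})
          (joinPower (TopCat.of (pathsFromEnd A ⁻¹' {z})) k))) ∧
    ((∃ g : C(X, (ganeaBundle f X' k).total), ∀ x, (ganeaBundle f X' k).proj (g x) = x) →
      ∃ U : Fin (k + 1) → Set X, (∀ i, IsOpen (U i)) ∧ (⋃ i, U i) = Set.univ ∧
        ∀ i, FiberwiseDeformable f (U i) X') := by
  refine ⟨(hasPathLifting_ganeaBundle hf k).isHurewiczFibration, fun y e he x => ?_, ?_⟩
  · obtain ⟨h⟩ := nonempty_ganeaBundle_fiber_homeomorph e he x k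
    refine ⟨⟨h⟩, fun z hz => ?_⟩
    obtain ⟨h'⟩ := nonempty_homotopyEquiv_joinPower (F := TopCat.of (pathsFromEnd A ⁻¹' {e x}))
      (F' := TopCat.of (pathsFromEnd A ⁻¹' {z})) (nonempty_homotopyEquiv_pathsFromEnd_fiber A hz) k
    exact ⟨h.toHomotopyEquiv.trans h'⟩
  · rintro ⟨g, hg⟩
    exact exists_cover_of_section k isOpen_univ (g.continuous.comp continuous_subtype_val)
      fun x => hg x
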